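/- **Notation.** All functions are real-valued and $2\pi$-periodic on $\mathbb R$. $C$ is the space of continuous functions with $\|f\|_C=\max_t|f(t)|$; $L_s$, $1\le s\le\infty$, is the Lebesgue space with norm $\|f\|_s=\big(\int_0^{2\pi}|f(t)|^s\,dt\big)^{1/s}$ for $s<\infty$ and $\|f\|_\infty=\operatorname{ess\,sup}|f|$. For $f\in L_1$ let $a_k,b_k$ be its Fourier coefficients ($a_k=\frac1\pi\int_0^{2\pi}f(x)\cos kx\,dx$, $b_k=\frac1\pi\int_0^{2\pi}f(x)\sin kx\,dx$) and $S_k(f)$ its Fourier partial sum of order $k$. For $n,p\in\mathbb N$, $p\le n$, the de la Vallée Poussin sums are $V_{n,p}(f)=\frac1p\sum_{k=n-p}^{n-1}S_k(f)$. Let $\psi(k)>0$ $(k\ge1)$ and $\beta\in\mathbb R$. A function $\varphi\in L_1$ is the $(\psi,\beta)$-derivative of $f\in L_1$, written $\varphi=f^\psi_\beta$, if $$\sum_{k=1}^\infty\frac1{\psi(k)}\Big(a_k\cos\big(kx+\tfrac{\beta\pi}2\big)+b_k\sin\big(kx+\tfrac{\beta\pi}2\big)\Big)$$ is the Fourier series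 of $\varphi$. $C^\psi_\beta L_s$ is the set of $f\in C$ that have a $(\psi,\beta)$-derivative $f^\psi_\beta\in L_s$. $E_m(g)_{L_s}$ is the infimum of $\|g-t\|_s$ over trigonometric polynomials $t$ of order at most $m-1$. Further, $s'$ is given by $\frac1s+\frac1{s'}=1$, $$K_{q,p}(u)=2^{-1/u}\Big\|\frac{\sqrt{1-2q^p\cos pt+q^{2p}}}{1-2q\cos t+q^2}\Big\|_u,\qquad \varepsilon_m=\varepsilon_m(\psi)=\sup_{k\ge m}\Big|\frac{\psi(k+1)}{\psi(k)}-q\Big|,$$ $\delta(2)=0$ and $\delta(s)=1$ for $s\ne2$; $\sigma(u,p)=1$ if $u=1$, $p=1$; $\sigma(u,p)=2$ if $1<u\le\infty$, $p=1$; $\sigma(u,p)=3$ if $p\ge2$. **Theorem.** Let $0<q<1$, and let $\psi(k)>0$ satisfy $\lim_{k\to\infty}\psi(k+1)/\psi(k)=q$. Let $\beta\in\mathbb R$, $1\le s\le\infty$, $n,p\in\mathbb N$, $p\le n$. Write $$A=\frac{\|\cos t\|_{s'}}{\pi^{1+1/s'}}K_{q,p}(s'),\qquad R=\frac{q\,\delta(s)}{(n-p+1)(1-q)^{\sigma(s',p)}}+\frac{\varepsilon_{n-p+1}}{(1-q)^2}\min\Big\{p,\frac1{1-q}\Big\}.$$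 1. For every $f\in C^\psi_\beta L_s$, $$\|f-V_{n,p}(f)\|_C\le\frac{\psi(n-p+1)}p\,\big(A+O(1)\,R\big)\,E_{n-p+1}(f^\psi_\beta)_{L_s}.$$ 2. For every $f\in C^\psi_\beta L_s$ (and every such $n,p$) there is a function $F=F(f;n;p)\in C^\psi_\beta L_s$ such that $E_{n-p+1}(F^\psi_\beta)_{L_s}=E_{n-p+1}(f^\psi_\beta)_{L_s}$ and $$\|F-V_{n,p}(F)\|_C=\frac{\psi(n-p+1)}p\,\big(A+O(1)\,R\big)\,E_{n-p+1}(F^\psi_\beta)_{L_s}.$$ In both relations $O(1)$ is a real number that is bounded in absolute value as follows. There is an absolute constant $C$ (independent of all parameters), and for each $\psi$ (with its $q$) there are a number $N$ and a constant $C'$ depending only on $\psi$, such that for all $\beta,s,n,p,f$ one has $|O(1)|\le C$ whenever $n-p\ge N$, and $|O(1)|\le C'$ for all $p\le n$. -/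

import Mathlib

open MeasureTheory Filter Topology
open scoped ENNReal

noncomputable section

namespace DeLaValleePoussin

/-- Lebesgue measure on one period `(0, 2π]`. -/
def periodMeasure : Measure ℝ := volume.restrict (Set.Ioc 0 (2 * Real.pi))

/-- `g ∈ L_s`: `g` is `2π`-periodic, measurable up to null sets, and its `L_s`-norm over a period
is finite. -/
def MemLs (s : ℝ≥0∞) (g : ℝ → ℝ) : Prop :=
  Function.Periodic g (2 * Real.pi) ∧ MemLp g s periodMeasure

/-- `‖g‖_{L_s}`, the norm over one period (the essential supremum of `|g|` for `s = ∞`). -/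
def normLs (s : ℝ≥0∞) (g : ℝ → ℝ) : ℝ := (eLpNorm g s periodMeasure).toReal

/-- `‖g‖_C`, used for continuous `2π`-periodic `g`. -/
def normC (g : ℝ → ℝ) : ℝ := ⨆ x : ℝ, |g x|

/-- Fourier coefficient `a_k = (1/π) ∫ g(x) cos kx dx` over a period. -/
def fourierA (g : ℝ → ℝ) (k : ℕ) : ℝ :=
  (1 / Real.pi) * ∫ x in (0 : ℝ)..(2 * Real.pi), g x * Real.cos (k * x)

/-- Fourier coefficient `b_k = (1/π) ∫ g(x) sin kx dx` over a period. -/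
def fourierB (g : ℝ → ℝ) (k : ℕ) : ℝ :=
  (1 / Real.pi) * ∫ x in (0 : ℝ)..(2 * Real.pi), g x * Real.sin (k * x)

/-- Partial Fourier sum `S_k(g; x)` of order `k`. -/
def fourierSum (g : ℝ → ℝ) (k : ℕ) (x : ℝ) : ℝ :=
  fourierA g 0 / 2 +
    ∑ j ∈ Finset.Icc 1 k, (fourierA g j * Real.cos (j * x) + fourierB g j * Real.sin (j * x))

/-- De la Vallée Poussin sum `V_{n,p}(g; x) = (1/p) ∑_{k=n-p}^{n-1} S_k(g; x)`, for `1 ≤ p ≤ n`. -/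
def vpSum (n p : ℕ) (g : ℝ → ℝ) (x : ℝ) : ℝ :=
  (1 / (p : ℝ)) * ∑ k ∈ Finset.Ico (n - p) n, fourierSum g k x

/-- `ρ_{n,p}(g; x) = g(x) - V_{n,p}(g; x)`. -/
def vpDeviation (n p : ℕ) (g : ℝ → ℝ) (x : ℝ) : ℝ := g x - vpSum n p g x

/-- `φ` is a `(ψ,β)`-derivative of `f`: both are `2π`-periodic and summable over a period, and
`∑_{k ≥ 1} (1/ψ(k)) (a_k cos(kx + βπ/2) + b_k sin(kx + βπ/2))`, where `a_k`, `b_k` are the Fourier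
coefficients of `f`, is the Fourier series of `φ`. -/
def IsPsiBetaDeriv (ψ : ℕ → ℝ) (β : ℝ) (f φ : ℝ → ℝ) : Prop :=
  MemLs 1 f ∧ MemLs 1 φ ∧ fourierA φ 0 = 0 ∧
    ∀ k : ℕ, 1 ≤ k → ∀ x : ℝ,
      fourierA φ k * Real.cos (k * x) + fourierB φ k * Real.sin (k * x) =
        (1 / ψ k) * (fourierA f k * Real.cos (k * x + β * Real.pi / 2) +
          fourierB f k * Real.sin (k * x + β * Real.pi / 2))

/-- `f ∈ C^ψ_β L_s` with `f^ψ_β = φ`: `f` is continuous and `φ ∈ L_s` is its `(ψ,β)`-derivative. -/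
def MemCPsiBeta (ψ : ℕ → ℝ) (β : ℝ) (s : ℝ≥0∞) (f φ : ℝ → ℝ) : Prop :=
  Continuous f ∧ IsPsiBetaDeriv ψ β f φ ∧ MemLs s φ

/-- Real trigonometric polynomials of order at most `N`. -/
def trigPoly (N : ℕ) : Set (ℝ → ℝ) :=
  {t | ∃ (c : ℝ) (a b : ℕ → ℝ), t = fun x : ℝ =>
    c + ∑ k ∈ Finset.Icc 1 N, (a k * Real.cos (k * x) + b k * Real.sin (k * x))}

/-- Best approximation `E_m(g)_{L_s}` by trigonometric polynomials of order at most `m - 1`,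
for `m ≥ 1`. -/
def bestApprox (s : ℝ≥0∞) (m : ℕ) (g : ℝ → ℝ) : ℝ :=
  sInf ((fun t : ℝ → ℝ => normLs s (fun x => g x - t x)) '' trigPoly (m - 1))

/-- `K_{q,p}(u) = 2^{-1/u} ‖√(1 - 2 q^p cos pt + q^{2p}) / (1 - 2 q cos t + q²)‖_u`. -/
def kConst (q : ℝ) (p : ℕ) (u : ℝ≥0∞) : ℝ :=
  (2 : ℝ) ^ (-(u⁻¹).toReal) *
    normLs u (fun t : ℝ => Real.sqrt (1 - 2 * q ^ p * Real.cos (p * t) + q ^ (2 * p)) /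
      (1 - 2 * q * Real.cos t + q ^ 2))

/-- `σ(u,p)`. -/
def sigmaExp (u : ℝ≥0∞) (p : ℕ) : ℕ :=
  if p = 1 then (if u = 1 then 1 else 2) else 3

/-- `δ(s)`. -/
def deltaInd (s : ℝ≥0∞) : ℝ := if s = 2 then 0 else 1

/-- `ε_m(ψ) = sup_{k ≥ m} |ψ(k+1)/ψ(k) - q|`. -/
def epsSeq (ψ : ℕ → ℝ) (q : ℝ) (m : ℕ) : ℝ :=
  sSup ((fun k : ℕ => |ψ (k + 1) / ψ k - q|) '' Set.Ici m)

/-- The principal constant `‖cos t‖_{s'} π^{-1-1/s'} K_{q,p}(s')`. -/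
def mainConst (q : ℝ) (p : ℕ) (s' : ℝ≥0∞) : ℝ :=
  normLs s' Real.cos / Real.pi ^ (1 + (s'⁻¹).toReal) * kConst q p s'

/-- The quantity multiplied by `O(1)`, with `m = n - p + 1`. -/
def remainder (ψ : ℕ → ℝ) (q : ℝ) (s s' : ℝ≥0∞) (m p : ℕ) : ℝ :=
  q * deltaInd s / ((m : ℝ) * (1 - q) ^ sigmaExp s' p) +
    epsSeq ψ q m / (1 - q) ^ 2 * min (p : ℝ) (1 / (1 - q))

end DeLaValleePoussin

end

open DeLaValleePoussin

/-! Passing from f to f - V_{n,p}(f) multiplies the harmonic of order k by min(k - (n-p), p)/p, read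
as 0 for k ≤ n-p. In terms of φ = f^ψ_β the deviation is therefore a convolution with the kernel
K(t) = ∑ min(k-(n-p), p)/p · ψ(k) cos(kt - βπ/2), whose spectrum starts at m = n-p+1
(`vpDeviation_eq_integral`). Any polynomial of order at most m-1 may be subtracted from φ, so
Hölder's inequality bounds the deviation by (1/π)‖K‖_{s'} E_m(φ). Conversely, a function nearly
extremal in Hölder's inequality, made mean-free and rescaled to the prescribed best approximation,
attains this bound up to a factor 1-η (`exists_extremal`). Both parts thus reduce to the asymptotics
of ‖K‖_{s'}.

After normalisation by p/ψ(m), replacing ψ(m+j)/ψ(m) by q^j turns K into the wave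
Re(G(t)e^{i(mt+θ)}), where G(t) = (1-w^p)/(1-w)², w = qe^{it}, and θ = -βπ/2. The cost is at most a
constant times ∑ min(j+1,p)|ψ(m+j)/ψ(m) - q^j|, which yields the ε_m term of R
(`tsum_min_mul_abs_le`).

For a finite exponent u, Fubini gives the average over θ of the u-th power of the wave's norm
exactly: it is the u-th power of πA, with A formed for the exponent u. Hence some phases give a norm
at least πA and others at most πA (`exists_wave_ge_le`; u = ∞ is done by hand). A translation of t
by τ ≤ 2π/m realises any change of phase while moving G only by O(q|τ|/(1-q)^σ). So every phase has
norm πA + O(q/(m(1-q)^σ)), the first term of R. For u = 2 the norm does not depend on θ, because ∫(G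
e^{imt})² = 0; this is the role of δ(2) = 0. -/

namespace DeLaValleePoussin

/-! ### Norms over one period -/

instance : IsFiniteMeasure periodMeasure := by
  unfold periodMeasure; infer_instance

instance fact_two_pi_pos : Fact (0 < 2 * Real.pi) := ⟨Real.two_pi_pos⟩

lemma periodMeasure_univ : periodMeasure Set.univ = ENNReal.ofReal (2 * Real.pi) := by
  simp [periodMeasure]

lemma periodMeasure_ne_zero : periodMeasure ≠ 0 := by
  intro h
  have := periodMeasure_univ
  rw [h] at this
  simp at this
  linarith [Real.pi_pos]

lemma integral_periodMeasure {E : Type*} [NormedAddCommGroup E] [NormedSpace ℝ E] (f : ℝ → E) :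
    ∫ x, f x ∂periodMeasure = ∫ x in (0 : ℝ)..(2 * Real.pi), f x := by
  rw [intervalIntegral.integral_of_le Real.two_pi_pos.le, periodMeasure]

lemma exists_bound_of_continuous {g : ℝ → ℝ} (hg : Continuous g) :
    ∃ M, ∀ᵐ x ∂periodMeasure, ‖g x‖ ≤ M := by
  obtain ⟨M, hM⟩ := (isCompact_Icc (a := (0 : ℝ)) (b := 2 * Real.pi)).exists_bound_of_continuousOn
    hg.continuousOn
  refine ⟨M, ?_⟩
  rw [periodMeasure, ae_restrict_iff' measurableSet_Ioc]
  exact .of_forall fun x hx => hM x (Set.Ioc_subset_Icc_self hx)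

lemma memLp_of_continuous {g : ℝ → ℝ} (hg : Continuous g) (s : ℝ≥0∞) :
    MemLp g s periodMeasure := by
  obtain ⟨M, hM⟩ := exists_bound_of_continuous hg
  exact MemLp.of_bound hg.aestronglyMeasurable M hM

lemma integrable_of_continuous {g : ℝ → ℝ} (hg : Continuous g) : Integrable g periodMeasure :=
  memLp_one_iff_integrable.1 (memLp_of_continuous hg 1)

lemma normLs_nonneg (s : ℝ≥0∞) (g : ℝ → ℝ) : 0 ≤ normLs s g := ENNReal.toReal_nonneg

lemma normLs_add_le {u : ℝ≥0∞} (hu : 1 ≤ u) {f g : ℝ → ℝ} (hf : MemLp f u periodMeasure)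
    (hg : MemLp g u periodMeasure) :
    normLs u (fun t => f t + g t) ≤ normLs u f + normLs u g := by
  unfold normLs
  rw [← ENNReal.toReal_add hf.eLpNorm_ne_top hg.eLpNorm_ne_top]
  exact ENNReal.toReal_mono (ENNReal.add_ne_top.2 ⟨hf.eLpNorm_ne_top, hg.eLpNorm_ne_top⟩)
    (eLpNorm_add_le hf.1 hg.1 hu)

lemma normLs_mono {u : ℝ≥0∞} {f g : ℝ → ℝ} (hg : MemLp g u periodMeasure)
    (h : ∀ t, |f t| ≤ |g t|) : normLs u f ≤ normLs u g :=
  ENNReal.toReal_mono hg.eLpNorm_ne_top (eLpNorm_mono h)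

lemma normLs_const_mul (u : ℝ≥0∞) (c : ℝ) (f : ℝ → ℝ) :
    normLs u (fun t => c * f t) = |c| * normLs u f := by
  unfold normLs
  have := eLpNorm_const_smul c f u periodMeasure
  have h2 : (c • f) = fun t => c * f t := rfl
  rw [h2] at this
  rw [this, ENNReal.toReal_mul]
  simp

/-- Reverse triangle inequality with the difference dominated by a third function. -/
lemma normLs_le_add {u : ℝ≥0∞} (hu : 1 ≤ u) {f g : ℝ → ℝ} (hf : Continuous f) (hg : Continuous g) :
    normLs u f ≤ normLs u g + normLs u (fun t => f t - g t) := by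
  have := normLs_add_le hu (memLp_of_continuous hg u) (memLp_of_continuous (hf.sub hg) u)
  refine le_trans (le_of_eq ?_) this
  congr 1; ext t; simp

lemma toReal_inv_le_one {u : ℝ≥0∞} (hu : 1 ≤ u) : (u⁻¹).toReal ≤ 1 := by
  have : u⁻¹ ≤ 1 := ENNReal.inv_le_one.2 hu
  exact ENNReal.toReal_mono ENNReal.one_ne_top this

lemma two_pi_rpow_le {u : ℝ≥0∞} (hu : 1 ≤ u) :
    (2 * Real.pi) ^ ((u⁻¹).toReal) ≤ 2 * Real.pi := by
  have h1 : (1 : ℝ) ≤ 2 * Real.pi := by linarith [Real.pi_gt_three]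
  calc (2 * Real.pi) ^ ((u⁻¹).toReal) ≤ (2 * Real.pi) ^ (1 : ℝ) :=
        Real.rpow_le_rpow_of_exponent_le h1 (toReal_inv_le_one hu)
    _ = _ := Real.rpow_one _

lemma normLs_le_of_bound {u : ℝ≥0∞} (hu : 1 ≤ u) {f : ℝ → ℝ} {D : ℝ} (hD : 0 ≤ D)
    (h : ∀ t, |f t| ≤ D) : normLs u f ≤ 2 * Real.pi * D := by
  have h1 := eLpNorm_le_of_ae_bound (p := u) (μ := periodMeasure) (f := f) (C := D)
    (.of_forall h)
  rw [periodMeasure_univ] at h1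
  have h2 := ENNReal.toReal_mono (by
    refine ENNReal.mul_ne_top (ENNReal.rpow_ne_top_of_nonneg (by positivity) ENNReal.ofReal_ne_top)
      ENNReal.ofReal_ne_top) h1
  rw [ENNReal.toReal_mul, ← ENNReal.toReal_rpow, ENNReal.toReal_ofReal Real.two_pi_pos.le,
    ENNReal.toReal_ofReal hD, ← ENNReal.toReal_inv] at h2
  exact h2.trans (mul_le_mul_of_nonneg_right (two_pi_rpow_le hu) hD)

/-- On the circle, translations and reflection preserve Haar measure, so moving the norm there makes
its invariance under t ↦ t + τ and t ↦ -t immediate. -/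
lemma eLpNorm_eq_addCircle {f : ℝ → ℝ} (hf : Continuous f)
    (hp : Function.Periodic f (2 * Real.pi)) (u : ℝ≥0∞) (a : ℝ) :
    eLpNorm f u (volume.restrict (Set.Ioc a (a + 2 * Real.pi))) =
      eLpNorm (hp.lift : AddCircle (2 * Real.pi) → ℝ) u volume := by
  have hc : Continuous (hp.lift : AddCircle (2 * Real.pi) → ℝ) := hf.quotient_lift _
  have h := eLpNorm_comp_measurePreserving (p := u) hc.aestronglyMeasurable
    (AddCircle.measurePreserving_mk (2 * Real.pi) a)
  rw [← h]; rfl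

lemma normLs_eq_addCircle {f : ℝ → ℝ} (hf : Continuous f)
    (hp : Function.Periodic f (2 * Real.pi)) (u : ℝ≥0∞) :
    normLs u f = (eLpNorm (hp.lift : AddCircle (2 * Real.pi) → ℝ) u volume).toReal := by
  have := eLpNorm_eq_addCircle hf hp u 0
  rw [zero_add] at this
  rw [normLs, periodMeasure, this]

lemma normLs_comp_add {f : ℝ → ℝ} (hf : Continuous f)
    (hp : Function.Periodic f (2 * Real.pi)) (u : ℝ≥0∞) (τ : ℝ) :
    normLs u (fun t => f (t + τ)) = normLs u f := by
  have hp' : Function.Periodic (fun t => f (t + τ)) (2 * Real.pi) := by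
    intro t; dsimp only; rw [← hp (t + τ)]; ring_nf
  rw [normLs_eq_addCircle hf hp, normLs_eq_addCircle (by fun_prop) hp']
  have hc : Continuous (hp.lift : AddCircle (2 * Real.pi) → ℝ) := hf.quotient_lift _
  rw [← eLpNorm_comp_measurePreserving (p := u) hc.aestronglyMeasurable
    (measurePreserving_add_right volume (τ : AddCircle (2 * Real.pi)))]
  congr 2
  ext x
  induction x using QuotientAddGroup.induction_on with
  | H z => rfl

lemma normLs_comp_neg {f : ℝ → ℝ} (hf : Continuous f)
    (hp : Function.Periodic f (2 * Real.pi)) (u : ℝ≥0∞) :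
    normLs u (fun t => f (-t)) = normLs u f := by
  have hp' : Function.Periodic (fun t => f (-t)) (2 * Real.pi) := by
    intro t; dsimp only; rw [← hp (-(t + 2 * Real.pi))]; ring_nf
  rw [normLs_eq_addCircle hf hp, normLs_eq_addCircle (by fun_prop) hp']
  have hc : Continuous (hp.lift : AddCircle (2 * Real.pi) → ℝ) := hf.quotient_lift _
  rw [← eLpNorm_comp_measurePreserving (p := u) hc.aestronglyMeasurable
    (Measure.measurePreserving_neg volume)]
  congr 2
  ext x
  induction x using QuotientAddGroup.induction_on with
  | H z => rfl

lemma normLs_comp_sub_left {f : ℝ → ℝ} (hf : Continuous f)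
    (hp : Function.Periodic f (2 * Real.pi)) (u : ℝ≥0∞) (x : ℝ) :
    normLs u (fun t => f (x - t)) = normLs u f := by
  have hp' : Function.Periodic (fun t => f (t + x)) (2 * Real.pi) := by
    intro t; dsimp only; rw [← hp (t + x)]; ring_nf
  rw [← normLs_comp_add hf hp u x, ← normLs_comp_neg (by fun_prop) hp']
  congr 1; ext t; ring_nf

/-- The point π is interior to the period interval, so a strict violation would persist on an open
set of positive measure. Other points are brought to π by translation. -/
lemma abs_pi_le_normLs_top {f : ℝ → ℝ} (hf : Continuous f) : |f Real.pi| ≤ normLs ∞ f := by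
  have h := (memLp_of_continuous hf ∞).eLpNorm_ne_top
  have h1 : ∀ᵐ x ∂periodMeasure, |f x| ≤ normLs ∞ f := by
    filter_upwards [ae_le_eLpNormEssSup (f := f) (μ := periodMeasure)] with x hx
    rw [← eLpNorm_exponent_top] at hx
    have := ENNReal.toReal_mono h hx
    simpa [normLs] using this
  by_contra! hlt
  have hopen : IsOpen ({x | normLs ∞ f < |f x|} ∩ Set.Ioo 0 (2 * Real.pi)) :=
    (isOpen_lt continuous_const hf.abs).inter isOpen_Ioo
  have hpos : 0 < volume ({x | normLs ∞ f < |f x|} ∩ Set.Ioo 0 (2 * Real.pi)) :=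
    hopen.measure_pos _ ⟨Real.pi, hlt, Real.pi_pos, by linarith [Real.pi_pos]⟩
  have h0 : periodMeasure {x | normLs ∞ f < |f x|} = 0 := by
    rw [ae_iff] at h1
    simpa using h1
  rw [periodMeasure, Measure.restrict_apply (isOpen_lt continuous_const hf.abs).measurableSet] at h0
  exact hpos.ne' (measure_mono_null
    (Set.inter_subset_inter_right _ Set.Ioo_subset_Ioc_self) h0)

lemma abs_le_normLs_top {f : ℝ → ℝ} (hf : Continuous f)
    (hp : Function.Periodic f (2 * Real.pi)) (x : ℝ) : |f x| ≤ normLs ∞ f := by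
  rw [← normLs_comp_add hf hp ∞ (x - Real.pi)]
  have := abs_pi_le_normLs_top (f := fun t => f (t + (x - Real.pi))) (by fun_prop)
  simpa using this

lemma normLs_rpow {u : ℝ≥0∞} (h0 : u ≠ 0) (ht : u ≠ ∞) {f : ℝ → ℝ}
    (hf : MemLp f u periodMeasure) :
    normLs u f ^ u.toReal = ∫ t, |f t| ^ u.toReal ∂periodMeasure := by
  rw [normLs, hf.eLpNorm_eq_integral_rpow_norm h0 ht]
  have : 0 ≤ ∫ t, ‖f t‖ ^ u.toReal ∂periodMeasure := integral_nonneg fun t => by positivity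
  rw [ENNReal.toReal_ofReal (by positivity), ← Real.rpow_mul this,
    inv_mul_cancel₀ (ENNReal.toReal_ne_zero.2 ⟨h0, ht⟩), Real.rpow_one]
  rfl

lemma normLs_one {f : ℝ → ℝ} (hf : MemLp f 1 periodMeasure) :
    normLs 1 f = ∫ t, |f t| ∂periodMeasure := by
  simpa using normLs_rpow one_ne_zero ENNReal.one_ne_top hf

/-! ### Hölder's inequality and termwise integration -/

lemma abs_integral_mul_le {s s' : ℝ≥0∞} (hss : s⁻¹ + s'⁻¹ = 1) {f g : ℝ → ℝ}
    (hf : MemLp f s periodMeasure) (hg : MemLp g s' periodMeasure) :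
    |∫ t, f t * g t ∂periodMeasure| ≤ normLs s f * normLs s' g := by
  have : s.HolderTriple s' 1 := ⟨by simpa using hss⟩
  have h1 : MemLp (fun t => f t * g t) 1 periodMeasure := by
    have := hg.smul (r := 1) hf
    exact this
  calc |∫ t, f t * g t ∂periodMeasure| ≤ ∫ t, |f t * g t| ∂periodMeasure :=
        abs_integral_le_integral_abs
    _ = normLs 1 (fun t => f t * g t) := (normLs_one h1).symm
    _ ≤ normLs s f * normLs s' g := by
        unfold normLs
        rw [← ENNReal.toReal_mul]
        refine ENNReal.toReal_mono (ENNReal.mul_ne_top hf.eLpNorm_ne_top hg.eLpNorm_ne_top) ?_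
        have h := eLpNorm_smul_le_mul_eLpNorm (p := s) (q := s') (r := 1) hg.1 hf.1
        exact h

lemma integrable_mul_of_continuous {f g : ℝ → ℝ} (hf : Integrable f periodMeasure)
    (hg : Continuous g) : Integrable (fun t => f t * g t) periodMeasure := by
  obtain ⟨M, hM⟩ := exists_bound_of_continuous hg
  exact hf.mul_bdd hg.aestronglyMeasurable hM

lemma hasSum_integral_mul {u : ℕ → ℝ → ℝ} {B : ℕ → ℝ} (hu : ∀ k, Continuous (u k))
    (hB : ∀ k x, |u k x| ≤ B k) (hs : Summable B) {g : ℝ → ℝ} (hg : Integrable g periodMeasure) :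
    HasSum (fun k => ∫ x, g x * u k x ∂periodMeasure)
      (∫ x, g x * ∑' k, u k x ∂periodMeasure) := by
  refine hasSum_integral_of_dominated_convergence (fun k x => |g x| * B k) ?_ ?_ ?_ ?_ ?_
  · intro k; exact (integrable_mul_of_continuous hg (hu k)).1
  · intro k
    refine .of_forall fun x => ?_
    rw [Real.norm_eq_abs, abs_mul]
    exact mul_le_mul_of_nonneg_left (hB k x) (abs_nonneg _)
  · exact .of_forall fun x => hs.mul_left _
  · simp_rw [tsum_mul_left]
    exact hg.abs.mul_const _
  · refine .of_forall fun x => ?_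
    have h1 : Summable fun k => u k x := Summable.of_norm_bounded hs fun k => hB k x
    exact h1.hasSum.mul_left (g x)

/-! ### Orthogonality and Fourier coefficients -/

lemma integral_cos_int_mul_add {n : ℤ} (hn : n ≠ 0) (δ : ℝ) :
    ∫ x, Real.cos (n * x + δ) ∂periodMeasure = 0 := by
  have hn' : (n : ℝ) ≠ 0 := by exact_mod_cast hn
  rw [integral_periodMeasure, intervalIntegral.integral_comp_mul_add (fun x => Real.cos x) hn',
    integral_cos]
  have : (n : ℝ) * (2 * Real.pi) + δ = δ + n * (2 * Real.pi) := by ring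
  rw [this, Real.sin_add_int_mul_two_pi]
  simp

lemma integral_cos_mul_cos (j k : ℕ) (δ ε : ℝ) :
    ∫ x, Real.cos (j * x + δ) * Real.cos (k * x + ε) ∂periodMeasure =
      ((∫ x, Real.cos (((j : ℤ) - k : ℤ) * x + (δ - ε)) ∂periodMeasure) +
        ∫ x, Real.cos (((j : ℤ) + k : ℤ) * x + (δ + ε)) ∂periodMeasure) / 2 := by
  rw [← integral_add (integrable_of_continuous (by fun_prop))
    (integrable_of_continuous (by fun_prop)), ← integral_div]
  congr 1; ext x
  push_cast
  have h1 : ((j : ℝ) - k) * x + (δ - ε) = (j * x + δ) - (k * x + ε) := by ring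
  have h2 : ((j : ℝ) + k) * x + (δ + ε) = (j * x + δ) + (k * x + ε) := by ring
  rw [h1, h2, Real.cos_sub (j * x + δ), Real.cos_add (j * x + δ) (k * x + ε)]; ring

lemma integral_cos_mul_cos_of_ne {j k : ℕ} (h : j ≠ k) (δ ε : ℝ) :
    ∫ x, Real.cos (j * x + δ) * Real.cos (k * x + ε) ∂periodMeasure = 0 := by
  rw [integral_cos_mul_cos, integral_cos_int_mul_add (by omega),
    integral_cos_int_mul_add (by omega)]; simp

lemma integral_cos_mul_cos_self {k : ℕ} (h : k ≠ 0) (δ ε : ℝ) :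
    ∫ x, Real.cos (k * x + δ) * Real.cos (k * x + ε) ∂periodMeasure =
      Real.pi * Real.cos (δ - ε) := by
  rw [integral_cos_mul_cos, integral_cos_int_mul_add (n := (k : ℤ) + k) (by omega)]
  simp only [sub_self, Int.cast_zero, zero_mul, zero_add, integral_const, add_zero]
  rw [Measure.real, periodMeasure_univ, ENNReal.toReal_ofReal Real.two_pi_pos.le, smul_eq_mul]
  ring

lemma fourierA_eq (g : ℝ → ℝ) (k : ℕ) :
    fourierA g k = (1 / Real.pi) * ∫ x, g x * Real.cos (k * x) ∂periodMeasure := by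
  rw [fourierA, integral_periodMeasure]

lemma fourierB_eq (g : ℝ → ℝ) (k : ℕ) :
    fourierB g k = (1 / Real.pi) * ∫ x, g x * Real.sin (k * x) ∂periodMeasure := by
  rw [fourierB, integral_periodMeasure]

/-- The addition formula turns a phase-shifted harmonic into a convolution; summed over k, this
produces the kernel. -/
lemma harmonic_eq_integral {g : ℝ → ℝ} (hg : Integrable g periodMeasure) (k : ℕ) (x γ : ℝ) :
    fourierA g k * Real.cos (k * x - γ) + fourierB g k * Real.sin (k * x - γ) =
      (1 / Real.pi) * ∫ t, g t * Real.cos (k * (x - t) - γ) ∂periodMeasure := by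
  rw [fourierA_eq, fourierB_eq, mul_assoc, mul_assoc, ← mul_add, ← integral_mul_const,
    ← integral_mul_const, ← integral_add]
  · congr 2; ext t
    have : (k : ℝ) * (x - t) - γ = (k * x - γ) - k * t := by ring
    rw [this, Real.cos_sub (k * x - γ)]; ring
  · exact (integrable_mul_of_continuous hg (by fun_prop)).mul_const _
  · exact (integrable_mul_of_continuous hg (by fun_prop)).mul_const _

lemma abs_integral_mul_le_of_abs_le_one {g h : ℝ → ℝ} (hg : Integrable g periodMeasure)
    (hh : ∀ x, |h x| ≤ 1) :
    |∫ x, g x * h x ∂periodMeasure| ≤ ∫ x, |g x| ∂periodMeasure := by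
  refine norm_integral_le_of_norm_le (f := fun x => g x * h x) hg.abs (.of_forall fun x => ?_)
  rw [Real.norm_eq_abs, abs_mul]
  exact mul_le_of_le_one_right (abs_nonneg _) (hh x)

lemma abs_fourierA_le {g : ℝ → ℝ} (hg : Integrable g periodMeasure) (k : ℕ) :
    |fourierA g k| ≤ (1 / Real.pi) * ∫ x, |g x| ∂periodMeasure := by
  rw [fourierA_eq, abs_mul, abs_of_pos (by positivity : 0 < 1 / Real.pi)]
  exact mul_le_mul_of_nonneg_left
    (abs_integral_mul_le_of_abs_le_one hg fun x => Real.abs_cos_le_one _) (by positivity)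

lemma abs_fourierB_le {g : ℝ → ℝ} (hg : Integrable g periodMeasure) (k : ℕ) :
    |fourierB g k| ≤ (1 / Real.pi) * ∫ x, |g x| ∂periodMeasure := by
  rw [fourierB_eq, abs_mul, abs_of_pos (by positivity : 0 < 1 / Real.pi)]
  exact mul_le_mul_of_nonneg_left
    (abs_integral_mul_le_of_abs_le_one hg fun x => Real.abs_sin_le_one _) (by positivity)

/-! ### Absolutely convergent trigonometric series -/

/-- The trigonometric series with coefficients `a`, `b`. -/
noncomputable def trigSeries (a b : ℕ → ℝ) (x : ℝ) : ℝ :=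
  ∑' k : ℕ, (a k * Real.cos (k * x) + b k * Real.sin (k * x))

lemma abs_trig_term_le (a b θ : ℝ) : |a * Real.cos θ + b * Real.sin θ| ≤ |a| + |b| := by
  refine (abs_add_le _ _).trans (add_le_add ?_ ?_) <;> rw [abs_mul]
  · exact mul_le_of_le_one_right (abs_nonneg _) (Real.abs_cos_le_one _)
  · exact mul_le_of_le_one_right (abs_nonneg _) (Real.abs_sin_le_one _)

section
variable {a b : ℕ → ℝ}

lemma continuous_trigSeries (h : Summable fun k => |a k| + |b k|) :
    Continuous (trigSeries a b) :=
  continuous_tsum (fun k => by fun_prop) h fun k x => abs_trig_term_le _ _ _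

lemma periodic_trigSeries : Function.Periodic (trigSeries a b) (2 * Real.pi) := by
  intro x
  unfold trigSeries
  congr 1; ext k
  have : (k : ℝ) * (x + 2 * Real.pi) = k * x + k * (2 * Real.pi) := by ring
  rw [this, Real.cos_add_nat_mul_two_pi, Real.sin_add_nat_mul_two_pi]

/-- One free phase serves both families of coefficients: ε = 0 gives the cosine ones and ε = -π/2
the sine ones. -/
lemma integral_trigSeries_mul_cos (h : Summable fun k => |a k| + |b k|) {j : ℕ} (hj : j ≠ 0)
    (ε : ℝ) :
    ∫ x, trigSeries a b x * Real.cos (j * x + ε) ∂periodMeasure =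
      Real.pi * (a j * Real.cos ε - b j * Real.sin ε) := by
  have hs := hasSum_integral_mul (u := fun k x => a k * Real.cos (k * x) + b k * Real.sin (k * x))
    (fun k => by fun_prop) (fun k x => abs_trig_term_le _ _ _) h
    (integrable_of_continuous (g := fun x => Real.cos (j * x + ε)) (by fun_prop))
  have hterm : ∀ k : ℕ, ∫ x, Real.cos (j * x + ε) *
      (a k * Real.cos (k * x) + b k * Real.sin (k * x)) ∂periodMeasure =
      a k * (∫ x, Real.cos (j * x + ε) * Real.cos (k * x + 0) ∂periodMeasure) +
      b k * ∫ x, Real.cos (j * x + ε) * Real.cos (k * x + -(Real.pi / 2)) ∂periodMeasure := by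
    intro k
    rw [← integral_const_mul, ← integral_const_mul, ← integral_add
      (integrable_of_continuous (by fun_prop)) (integrable_of_continuous (by fun_prop))]
    congr 1; ext x
    rw [← sub_eq_add_neg, Real.cos_sub_pi_div_two, add_zero]; ring
  have hs2 := hasSum_single (f := fun k : ℕ => ∫ x, Real.cos (j * x + ε) *
      (a k * Real.cos (k * x) + b k * Real.sin (k * x)) ∂periodMeasure) j (by
    intro k hk
    rw [hterm, integral_cos_mul_cos_of_ne hk.symm, integral_cos_mul_cos_of_ne hk.symm]; simp)
  have := hs.unique hs2
  rw [hterm, integral_cos_mul_cos_self hj, integral_cos_mul_cos_self hj] at this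
  calc _ = ∫ x, Real.cos (j * x + ε) * ∑' k : ℕ, (a k * Real.cos (k * x) + b k * Real.sin (k * x))
        ∂periodMeasure := by
        congr 1; ext x; rw [mul_comm]; rfl
    _ = _ := by
        rw [this, sub_neg_eq_add, Real.cos_add_pi_div_two, sub_zero]; ring

lemma fourierA_trigSeries (h : Summable fun k => |a k| + |b k|) {j : ℕ} (hj : j ≠ 0) :
    fourierA (trigSeries a b) j = a j := by
  have := integral_trigSeries_mul_cos h hj 0
  simp only [add_zero] at this
  rw [fourierA_eq, this]
  have := Real.pi_ne_zero
  simp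

lemma fourierB_trigSeries (h : Summable fun k => |a k| + |b k|) {j : ℕ} (hj : j ≠ 0) :
    fourierB (trigSeries a b) j = b j := by
  have := integral_trigSeries_mul_cos h hj (-(Real.pi / 2))
  simp only [← sub_eq_add_neg, Real.cos_sub_pi_div_two] at this
  rw [fourierB_eq, this]
  have := Real.pi_ne_zero
  simp

end

lemma fourierCoeff_eq {f : ℝ → ℝ} (hf : Continuous f) (hp : Function.Periodic f (2 * Real.pi))
    (n : ℤ) :
    fourierCoeff (fun x : AddCircle (2 * Real.pi) => ((hp.lift x : ℝ) : ℂ)) n =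
      ((1 / Real.pi * ∫ x, f x * Real.cos (n * x) ∂periodMeasure : ℝ) -
        (1 / Real.pi * ∫ x, f x * Real.sin (n * x) ∂periodMeasure : ℝ) * Complex.I) / 2 := by
  rw [fourierCoeff_eq_intervalIntegral _ n 0, zero_add, ← integral_periodMeasure]
  have h1 : ∀ x : ℝ, (fourier (-n) (x : AddCircle (2 * Real.pi)) : ℂ) •
      ((hp.lift (x : AddCircle (2 * Real.pi)) : ℝ) : ℂ) =
      ((f x * Real.cos (n * x) : ℝ) : ℂ) - ((f x * Real.sin (n * x) : ℝ) : ℂ) * Complex.I := by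
    intro x
    rw [fourier_coe_apply, Function.Periodic.lift_coe]
    have : 2 * (Real.pi : ℂ) * Complex.I * ((-n : ℤ) : ℂ) * x / ((2 * Real.pi : ℝ) : ℂ) =
        ((-(n * x) : ℝ) : ℂ) * Complex.I := by
      have : (Real.pi : ℂ) ≠ 0 := by exact_mod_cast Real.pi_ne_zero
      push_cast; field_simp
    rw [this, Complex.exp_mul_I, ← Complex.ofReal_cos, ← Complex.ofReal_sin, Real.cos_neg,
      Real.sin_neg]
    push_cast; simp only [smul_eq_mul]; ring
  simp_rw [h1]
  have i1 : Integrable (fun x => f x * Real.cos (n * x)) periodMeasure :=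
    integrable_of_continuous (by fun_prop)
  have i2 : Integrable (fun x => f x * Real.sin (n * x)) periodMeasure :=
    integrable_of_continuous (by fun_prop)
  rw [integral_sub i1.ofReal (i2.ofReal.mul_const _), integral_mul_const, integral_complex_ofReal,
    integral_complex_ofReal]
  have : (Real.pi : ℂ) ≠ 0 := by exact_mod_cast Real.pi_ne_zero
  rw [Complex.real_smul]
  push_cast
  field_simp

/-- The complex Fourier series has absolutely summable coefficients, hence converges pointwise;
pairing n with -n gives the real form. The pairing counts the term of order 0 twice, which is the
source of the extra a₀/2. -/
lemma hasSum_fourier {f : ℝ → ℝ} (hf : Continuous f) (hp : Function.Periodic f (2 * Real.pi))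
    (h : Summable fun k => |fourierA f k| + |fourierB f k|) (x : ℝ) :
    HasSum (fun k : ℕ => fourierA f k * Real.cos (k * x) + fourierB f k * Real.sin (k * x))
      (f x + fourierA f 0 / 2) := by
  let F : C(AddCircle (2 * Real.pi), ℂ) :=
    ⟨fun x => ((hp.lift x : ℝ) : ℂ), Complex.continuous_ofReal.comp (hf.quotient_lift _)⟩
  have hpos : ∀ k : ℕ, fourierCoeff F (k : ℤ) = (fourierA f k - fourierB f k * Complex.I) / 2 := by
    intro k
    have := fourierCoeff_eq hf hp k
    rw [fourierA_eq, fourierB_eq]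
    exact_mod_cast this
  have hneg : ∀ k : ℕ, fourierCoeff F (-(k : ℤ)) =
      (fourierA f k + fourierB f k * Complex.I) / 2 := by
    intro k
    have := fourierCoeff_eq hf hp (-k)
    rw [fourierA_eq, fourierB_eq]
    simp only [Int.cast_neg, Int.cast_natCast, neg_mul, Real.cos_neg, Real.sin_neg, mul_neg,
      integral_neg, Complex.ofReal_neg, sub_neg_eq_add] at this
    exact this
  have hb : ∀ k : ℕ, ∀ c : ℂ, ‖c‖ ≤ 1 →
      ‖((fourierA f k : ℂ) + fourierB f k * c) / 2‖ ≤ |fourierA f k| + |fourierB f k| := by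
    intro k c hc
    rw [norm_div]
    have h1 : ‖(fourierA f k : ℂ) + fourierB f k * c‖ ≤ |fourierA f k| + |fourierB f k| := by
      refine (norm_add_le _ _).trans ?_
      rw [norm_mul, Complex.norm_real, Complex.norm_real]
      exact add_le_add le_rfl (mul_le_of_le_one_right (abs_nonneg _) hc)
    have : ‖(2 : ℂ)‖ = 2 := by simp
    rw [this]
    have h2 := norm_nonneg ((fourierA f k : ℂ) + fourierB f k * c)
    linarith
  have hsum : Summable (fourierCoeff F) := by
    refine Summable.of_nat_of_neg (Summable.of_norm_bounded h fun k => ?_)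
      (Summable.of_norm_bounded h fun k => ?_)
    · rw [hpos]
      have := hb k (-Complex.I) (by simp)
      rwa [mul_neg, ← sub_eq_add_neg] at this
    · rw [hneg]; exact hb k _ (by simp)
  have hs := (has_pointwise_sum_fourier_series_of_summable hsum (x : AddCircle (2 * Real.pi)))
  have hs2 := hs.nat_add_neg
  have hterm : ∀ n : ℤ, (fourier n (x : AddCircle (2 * Real.pi)) : ℂ) =
      Real.cos (n * x) + Real.sin (n * x) * Complex.I := by
    intro n
    rw [fourier_coe_apply]
    have : 2 * (Real.pi : ℂ) * Complex.I * (n : ℂ) * x / ((2 * Real.pi : ℝ) : ℂ) =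
        ((n * x : ℝ) : ℂ) * Complex.I := by
      have : (Real.pi : ℂ) ≠ 0 := by exact_mod_cast Real.pi_ne_zero
      push_cast; field_simp
    rw [this, Complex.exp_mul_I, ← Complex.ofReal_cos, ← Complex.ofReal_sin]
  have hs3 := Complex.hasSum_re hs2
  have e0 : fourierCoeff F 0 = (fourierA f 0 - fourierB f 0 * Complex.I) / 2 := hpos 0
  convert hs3 using 1
  · ext k
    rw [hpos, hneg, hterm, hterm]
    have h1 : (((-(k : ℤ) : ℤ) : ℝ)) * x = -(k * x) := by push_cast; ring
    have h2 : ((((k : ℤ) : ℤ) : ℝ)) * x = k * x := by push_cast; ring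
    rw [h1, h2, Real.cos_neg, Real.sin_neg, smul_eq_mul, smul_eq_mul]
    have : ((fourierA f k : ℂ) - fourierB f k * Complex.I) / 2 *
        ((Real.cos (k * x) : ℂ) + Real.sin (k * x) * Complex.I) +
        (fourierA f k + fourierB f k * Complex.I) / 2 *
        ((Real.cos (k * x) : ℂ) + (-Real.sin (k * x) : ℝ) * Complex.I) =
        ((fourierA f k * Real.cos (k * x) + fourierB f k * Real.sin (k * x) : ℝ) : ℂ) := by
      push_cast
      linear_combination (-(fourierB f k : ℂ)) * Complex.sin (k * x) * Complex.I_sq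
    rw [this, Complex.ofReal_re]
  · rw [e0, Complex.add_re]
    have h1 : (F (x : AddCircle (2 * Real.pi))) = ((f x : ℝ) : ℂ) := rfl
    have h2 : (((fourierA f 0 - fourierB f 0 * Complex.I) / 2 : ℂ) •
        (fourier 0 (x : AddCircle (2 * Real.pi)) : ℂ)).re = fourierA f 0 / 2 := by
      rw [hterm 0]; simp
    have h3 : (fourier 0) (x : AddCircle (2 * Real.pi)) = (1 : ℂ) := by rw [hterm 0]; simp
    rw [h1, h3, Complex.ofReal_re]; simp

lemma hasSum_congr {E : Type*} [AddCommMonoid E] [TopologicalSpace E] {f g : ℕ → E} {a : E}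
    (h : ∀ k, f k = g k) : HasSum f a ↔ HasSum g a := by
  rw [funext h]

/-! ### The deviation as a multiplier -/

/-- The factor by which `f ↦ f - V_{n,p}(f)` multiplies the harmonic of order `k`. -/
noncomputable def vpMult (n p k : ℕ) : ℝ := ((min (k - (n - p)) p : ℕ) : ℝ) / p

lemma vpMult_nonneg (n p k : ℕ) : 0 ≤ vpMult n p k := by unfold vpMult; positivity

lemma vpMult_le_one (n p k : ℕ) : vpMult n p k ≤ 1 := by
  unfold vpMult
  refine div_le_one_of_le₀ ?_ (by positivity)
  exact_mod_cast min_le_right _ _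

lemma vpMult_eq_zero {n p k : ℕ} (h : k ≤ n - p) : vpMult n p k = 0 := by
  unfold vpMult
  rw [Nat.sub_eq_zero_of_le h]; simp

lemma vpMult_eq_one {n p k : ℕ} (hp : 1 ≤ p) (hpn : p ≤ n) (h : n ≤ k) : vpMult n p k = 1 := by
  unfold vpMult
  rw [min_eq_right (by omega)]
  exact div_self (by positivity)

lemma fourierSum_eq (f : ℝ → ℝ) (k : ℕ) (x : ℝ) :
    fourierSum f k x = ∑ j ∈ Finset.range (k + 1),
      (fourierA f j * Real.cos (j * x) + fourierB f j * Real.sin (j * x)) - fourierA f 0 / 2 := by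
  rw [fourierSum, Finset.sum_range_succ', Finset.range_eq_Ico, Finset.sum_Ico_add'
    (fun j : ℕ => fourierA f j * Real.cos (j * x) + fourierB f j * Real.sin (j * x))]
  have : Finset.Ico (0 + 1) (k + 1) = Finset.Icc 1 k := by
    ext j; simp only [Finset.mem_Ico, Finset.mem_Icc]; omega
  rw [this]
  simp; ring

lemma vpSum_eq {n p : ℕ} (hp : 1 ≤ p) (hpn : p ≤ n) (f : ℝ → ℝ) (x : ℝ) :
    vpSum n p f x = ∑ j ∈ Finset.range n, (1 - vpMult n p j) *
      (fourierA f j * Real.cos (j * x) + fourierB f j * Real.sin (j * x)) - fourierA f 0 / 2 := by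
  set u : ℕ → ℝ := fun j => fourierA f j * Real.cos (j * x) + fourierB f j * Real.sin (j * x)
  have hp0 : (p : ℝ) ≠ 0 := by positivity
  have h1 : ∀ k ∈ Finset.Ico (n - p) n, fourierSum f k x =
      ∑ j ∈ Finset.range n, (if j ≤ k then u j else 0) - fourierA f 0 / 2 := by
    intro k hk
    rw [fourierSum_eq, ← Finset.sum_filter]
    congr 2
    ext j
    simp only [Finset.mem_Ico, Finset.mem_range, Finset.mem_filter] at *
    omega
  rw [vpSum, Finset.sum_congr rfl h1, Finset.sum_sub_distrib, Finset.sum_comm, Finset.sum_const,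
    Nat.card_Ico, mul_sub, Finset.mul_sum]
  congr 1
  · refine Finset.sum_congr rfl fun j hj => ?_
    rw [← Finset.sum_filter, Finset.sum_const]
    have : (Finset.Ico (n - p) n).filter (fun k => j ≤ k) = Finset.Ico (max j (n - p)) n := by
      ext k; simp only [Finset.mem_Ico, Finset.mem_filter]; omega
    rw [this, Nat.card_Ico, vpMult, nsmul_eq_mul]
    -- Among the p indices k in [n-p, n), those with j ≤ k contribute the harmonic j; the remaining
    -- min(j-(n-p), p) do not.
    have h2 : n - max j (n - p) + min (j - (n - p)) p = p := by
      simp only [Finset.mem_range] at hj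
      omega
    have h3 : ((n - max j (n - p) : ℕ) : ℝ) + ((min (j - (n - p)) p : ℕ) : ℝ) = p := by
      exact_mod_cast h2
    rw [eq_sub_of_add_eq h3]
    change _ = (1 - _ / (p : ℝ)) * u j
    field_simp
  · have : n - (n - p) = p := by omega
    rw [this, nsmul_eq_mul]
    field_simp

lemma hasSum_vpDeviation {n p : ℕ} (hp : 1 ≤ p) (hpn : p ≤ n) {f : ℝ → ℝ} (hf : Continuous f)
    (hper : Function.Periodic f (2 * Real.pi))
    (h : Summable fun k => |fourierA f k| + |fourierB f k|) (x : ℝ) :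
    HasSum (fun k : ℕ => vpMult n p k *
      (fourierA f k * Real.cos (k * x) + fourierB f k * Real.sin (k * x)))
      (vpDeviation n p f x) := by
  have h1 := hasSum_fourier hf hper h x
  have h2 : HasSum (fun k : ℕ => (1 - vpMult n p k) *
      (fourierA f k * Real.cos (k * x) + fourierB f k * Real.sin (k * x))) _ :=
    hasSum_sum_of_ne_finset_zero (s := Finset.range n) fun k hk => by
      rw [vpMult_eq_one hp hpn (by simpa using hk)]; simp
  have h3 : vpDeviation n p f x = f x - vpSum n p f x := rfl
  rw [h3, vpSum_eq hp hpn, ← sub_add, sub_add_eq_add_sub]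
  exact (hasSum_congr fun k => by ring).1 (h1.sub h2)

/-! ### Convolution with a cosine series -/

/-- The series `∑ c_k cos(kt - γ)`. -/
noncomputable def cosSeries (c : ℕ → ℝ) (γ t : ℝ) : ℝ := ∑' k : ℕ, c k * Real.cos (k * t - γ)

section
variable {c : ℕ → ℝ}

lemma abs_cosSeries_term_le (c : ℕ → ℝ) (γ t : ℝ) (k : ℕ) :
    |c k * Real.cos (k * t - γ)| ≤ |c k| := by
  rw [abs_mul]
  exact mul_le_of_le_one_right (abs_nonneg _) (Real.abs_cos_le_one _)

lemma continuous_cosSeries (hc : Summable fun k => |c k|) (γ : ℝ) :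
    Continuous (cosSeries c γ) :=
  continuous_tsum (fun k => by fun_prop) hc fun k x => abs_cosSeries_term_le _ _ _ _

lemma periodic_cosSeries (c : ℕ → ℝ) (γ : ℝ) :
    Function.Periodic (cosSeries c γ) (2 * Real.pi) := by
  intro x
  unfold cosSeries
  congr 1; ext k
  have : (k : ℝ) * (x + 2 * Real.pi) - γ = (k * x - γ) + k * (2 * Real.pi) := by ring
  rw [this, Real.cos_add_nat_mul_two_pi]

lemma hasSum_integral_mul_cosSeries (hc : Summable fun k => |c k|) (γ x : ℝ) {g : ℝ → ℝ}
    (hg : Integrable g periodMeasure) :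
    HasSum (fun k : ℕ => c k * ∫ t, g t * Real.cos (k * (x - t) - γ) ∂periodMeasure)
      (∫ t, g t * cosSeries c γ (x - t) ∂periodMeasure) := by
  have := hasSum_integral_mul (u := fun k t => c k * Real.cos (k * (x - t) - γ))
    (fun k => by fun_prop) (fun k t => abs_cosSeries_term_le _ _ _ _) hc hg
  refine (hasSum_congr fun k => ?_).1 this
  rw [← integral_const_mul]
  congr 1; ext t; ring

lemma integral_trigPoly_mul_cosSeries (hc : Summable fun k => |c k|) (γ x : ℝ) {N : ℕ}
    (hN : ∀ k ≤ N, c k = 0) {T : ℝ → ℝ} (hT : T ∈ trigPoly N) :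
    ∫ t, T t * cosSeries c γ (x - t) ∂periodMeasure = 0 := by
  obtain ⟨d, a, b, rfl⟩ := hT
  have hs := hasSum_integral_mul_cosSeries hc γ x
    (g := fun t => d + ∑ k ∈ Finset.Icc 1 N, (a k * Real.cos (k * t) + b k * Real.sin (k * t)))
    (integrable_of_continuous (by fun_prop))
  refine hs.unique ?_
  convert hasSum_zero using 1
  ext k
  rcases le_or_gt k N with hk | hk
  · rw [hN k hk, zero_mul]
  have key : ∀ j : ℕ, j ≠ k → ∀ δ : ℝ,
      ∫ t, Real.cos (j * t + δ) * Real.cos (k * (x - t) - γ) ∂periodMeasure = 0 := by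
    intro j hj δ
    rw [← integral_cos_mul_cos_of_ne hj δ (-(k * x - γ))]
    congr 1; ext t
    rw [← Real.cos_neg (k * (x - t) - γ)]; ring_nf
  have h0 : ∫ t, d * Real.cos (k * (x - t) - γ) ∂periodMeasure = 0 := by
    have := key 0 (by omega) 0
    simp only [Nat.cast_zero, zero_mul, add_zero, Real.cos_zero, one_mul] at this
    rw [integral_const_mul, this, mul_zero]
  have hint : ∀ h : ℝ → ℝ, Continuous h → Integrable h periodMeasure :=
    fun h hh => integrable_of_continuous hh
  simp only [add_mul, Finset.sum_mul]
  rw [integral_add (hint _ (by fun_prop)) (hint _ (by fun_prop)), h0,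
    integral_finsetSum _ fun j _ => hint _ (by fun_prop), Finset.sum_eq_zero, add_zero, mul_zero]
  intro j hj
  have hjk : j ≠ k := by simp only [Finset.mem_Icc] at hj; omega
  have h1 := key j hjk 0
  have h2 := key j hjk (-(Real.pi / 2))
  simp only [add_zero, ← sub_eq_add_neg, Real.cos_sub_pi_div_two] at h1 h2
  rw [integral_add (hint _ (by fun_prop)) (hint _ (by fun_prop))]
  simp only [mul_assoc]
  rw [integral_const_mul, integral_const_mul, h1, h2]; simp

end

/-! ### The kernel of the deviation and the upper estimate -/

section
variable {ψ : ℕ → ℝ} {β : ℝ} {s : ℝ≥0∞} {f φ : ℝ → ℝ}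

lemma IsPsiBetaDeriv.integrable (h : IsPsiBetaDeriv ψ β f φ) : Integrable φ periodMeasure :=
  memLp_one_iff_integrable.1 h.2.1.2

/-- Evaluating the defining identity at x - βπ/(2k) undoes the phase shift in the harmonic of order
k. -/
lemma IsPsiBetaDeriv.harmonic_eq (hψ : ∀ k : ℕ, 1 ≤ k → 0 < ψ k) (h : IsPsiBetaDeriv ψ β f φ)
    {k : ℕ} (hk : 1 ≤ k) (x : ℝ) :
    fourierA f k * Real.cos (k * x) + fourierB f k * Real.sin (k * x) =
      ψ k * (fourierA φ k * Real.cos (k * x - β * Real.pi / 2) +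
        fourierB φ k * Real.sin (k * x - β * Real.pi / 2)) := by
  have h1 := h.2.2.2 k hk (x - β * Real.pi / 2 / k)
  have hk0 : (k : ℝ) ≠ 0 := by positivity
  have e1 : (k : ℝ) * (x - β * Real.pi / 2 / k) = k * x - β * Real.pi / 2 := by field_simp
  rw [e1, sub_add_cancel] at h1
  rw [h1]
  have := (hψ k hk).ne'
  field_simp

lemma IsPsiBetaDeriv.summable (hψ : ∀ k : ℕ, 1 ≤ k → 0 < ψ k) (hs : Summable ψ)
    (h : IsPsiBetaDeriv ψ β f φ) : Summable fun k => |fourierA f k| + |fourierB f k| := by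
  set M := (1 / Real.pi) * ∫ x, |φ x| ∂periodMeasure
  rw [← summable_nat_add_iff 1]
  refine Summable.of_nonneg_of_le (fun k => by positivity) (fun k => ?_)
    (((summable_nat_add_iff 1).2 hs).mul_right (4 * M))
  have hpos := hψ (k + 1) (by omega)
  have hb : ∀ θ : ℝ, |fourierA φ (k + 1) * Real.cos θ + fourierB φ (k + 1) * Real.sin θ| ≤ 2 * M := by
    intro θ
    refine (abs_trig_term_le _ _ _).trans ?_
    have := abs_fourierA_le h.integrable (k + 1)
    have := abs_fourierB_le h.integrable (k + 1)
    linarith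
  -- The points 0 and π/(2(k+1)) isolate the cosine and the sine coefficient of f.
  have ha := h.harmonic_eq hψ (k := k + 1) (by omega) 0
  have hb' := h.harmonic_eq hψ (k := k + 1) (by omega) (Real.pi / 2 / (k + 1 : ℕ))
  have hk0 : ((k + 1 : ℕ) : ℝ) ≠ 0 := by positivity
  have e1 : ((k + 1 : ℕ) : ℝ) * (Real.pi / 2 / (k + 1 : ℕ)) = Real.pi / 2 := by field_simp
  rw [e1, Real.cos_pi_div_two, Real.sin_pi_div_two, mul_zero, zero_add, mul_one] at hb'
  rw [mul_zero, Real.cos_zero, Real.sin_zero, mul_zero, mul_one, add_zero] at ha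
  rw [ha, hb', abs_mul, abs_mul, abs_of_pos hpos]
  have h1 := mul_le_mul_of_nonneg_left (hb (0 - β * Real.pi / 2)) hpos.le
  have h2 := mul_le_mul_of_nonneg_left (hb (Real.pi / 2 - β * Real.pi / 2)) hpos.le
  linarith

/-- The kernel of the operator `f^ψ_β ↦ f - V_{n,p}(f)`. -/
noncomputable def vpKernel (ψ : ℕ → ℝ) (β : ℝ) (n p : ℕ) : ℝ → ℝ :=
  cosSeries (fun k => vpMult n p k * ψ k) (β * Real.pi / 2)

lemma summable_vpMult_mul (hs : Summable ψ) (n p : ℕ) :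
    Summable fun k => |vpMult n p k * ψ k| := by
  refine Summable.of_nonneg_of_le (fun k => abs_nonneg _) (fun k => ?_) hs.abs
  rw [abs_mul, abs_of_nonneg (vpMult_nonneg _ _ _)]
  exact mul_le_of_le_one_left (abs_nonneg _) (vpMult_le_one _ _ _)

lemma continuous_vpKernel (hs : Summable ψ) (β : ℝ) (n p : ℕ) : Continuous (vpKernel ψ β n p) :=
  continuous_cosSeries (summable_vpMult_mul hs n p) _

lemma periodic_vpKernel (ψ : ℕ → ℝ) (β : ℝ) (n p : ℕ) :
    Function.Periodic (vpKernel ψ β n p) (2 * Real.pi) :=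
  periodic_cosSeries _ _

lemma integral_trigPoly_mul_vpKernel (hs : Summable ψ) (β : ℝ) (n p : ℕ) (x : ℝ) {T : ℝ → ℝ}
    (hT : T ∈ trigPoly (n - p)) :
    ∫ t, T t * vpKernel ψ β n p (x - t) ∂periodMeasure = 0 :=
  integral_trigPoly_mul_cosSeries (summable_vpMult_mul hs n p) _ _
    (fun k hk => by rw [vpMult_eq_zero hk, zero_mul]) hT

lemma vpDeviation_eq_integral (hψ : ∀ k : ℕ, 1 ≤ k → 0 < ψ k) (hs : Summable ψ)
    (h : MemCPsiBeta ψ β s f φ) {n p : ℕ} (hp : 1 ≤ p) (hpn : p ≤ n) (x : ℝ) :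
    vpDeviation n p f x =
      (1 / Real.pi) * ∫ t, φ t * vpKernel ψ β n p (x - t) ∂periodMeasure := by
  have h1 := hasSum_vpDeviation hp hpn h.1 h.2.1.1.1 (h.2.1.summable hψ hs) x
  have h2 := (hasSum_integral_mul_cosSeries (summable_vpMult_mul hs n p) (β * Real.pi / 2) x
    h.2.1.integrable).mul_left (1 / Real.pi)
  refine h1.unique ((hasSum_congr fun k => ?_).2 h2)
  rcases Nat.eq_zero_or_pos k with rfl | hk
  · rw [vpMult_eq_zero (Nat.zero_le _)]; simp
  · rw [h.2.1.harmonic_eq hψ hk, harmonic_eq_integral h.2.1.integrable]; ring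

/-- The coefficients of F are those of Φ rotated by the angle γ and multiplied by ψ(k). They are
summable, so F is continuous; the zero mean of Φ is needed because a (ψ,β)-derivative has no
constant term. -/
lemma exists_memCPsiBeta (hψ : ∀ k : ℕ, 1 ≤ k → 0 < ψ k) (hs : Summable ψ) (β : ℝ)
    {Φ : ℝ → ℝ} (h1 : MemLs 1 Φ) (h2 : MemLs s Φ) (h0 : fourierA Φ 0 = 0) :
    ∃ F, MemCPsiBeta ψ β s F Φ := by
  have hint : Integrable Φ periodMeasure := memLp_one_iff_integrable.1 h1.2
  set γ := β * Real.pi / 2 with hγ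
  let a : ℕ → ℝ := fun k => ψ k * (fourierA Φ k * Real.cos γ + fourierB Φ k * -Real.sin γ)
  let b : ℕ → ℝ := fun k => ψ k * (fourierB Φ k * Real.cos γ + fourierA Φ k * Real.sin γ)
  set M := (1 / Real.pi) * ∫ x, |Φ x| ∂periodMeasure
  have hsum : Summable fun k => |a k| + |b k| := by
    refine Summable.of_nonneg_of_le (fun k => by positivity) (fun k => ?_) (hs.abs.mul_right (4 * M))
    have hA := abs_fourierA_le hint k
    have hB := abs_fourierB_le hint k
    have e1 : |fourierA Φ k * Real.cos γ + fourierB Φ k * -Real.sin γ| ≤ 2 * M := by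
      rw [← Real.sin_neg, ← Real.cos_neg]
      exact (abs_trig_term_le _ _ _).trans (by linarith)
    have e2 := abs_trig_term_le (fourierB Φ k) (fourierA Φ k) γ
    simp only [a, b, abs_mul]
    have := mul_le_mul_of_nonneg_left e1 (abs_nonneg (ψ k))
    have := mul_le_mul_of_nonneg_left (e2.trans (by linarith : _ ≤ 2 * M)) (abs_nonneg (ψ k))
    linarith
  have hcont := continuous_trigSeries hsum
  refine ⟨trigSeries a b, hcont, ⟨⟨periodic_trigSeries, memLp_of_continuous hcont 1⟩, h1, h0, ?_⟩,
    h2⟩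
  intro k hk x
  rw [fourierA_trigSeries hsum (by omega), fourierB_trigSeries hsum (by omega), ← hγ,
    Real.cos_add, Real.sin_add]
  simp only [a, b]
  have := (hψ k hk).ne'
  have h3 := Real.sin_sq_add_cos_sq γ
  field_simp
  linear_combination (-(fourierA Φ k * Real.cos (k * x)) - fourierB Φ k * Real.sin (k * x)) * h3

lemma continuous_of_mem_trigPoly {N : ℕ} {T : ℝ → ℝ} (hT : T ∈ trigPoly N) : Continuous T := by
  obtain ⟨d, a, b, rfl⟩ := hT
  fun_prop

lemma const_mem_trigPoly (N : ℕ) (d : ℝ) : (fun _ => d) ∈ trigPoly N :=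
  ⟨d, 0, 0, by simp⟩

lemma const_mul_mem_trigPoly {N : ℕ} {T : ℝ → ℝ} (hT : T ∈ trigPoly N) (d : ℝ) :
    (fun x => d * T x) ∈ trigPoly N := by
  obtain ⟨e, a, b, rfl⟩ := hT
  refine ⟨d * e, fun k => d * a k, fun k => d * b k, ?_⟩
  ext x
  rw [mul_add, Finset.mul_sum]
  congr 1
  exact Finset.sum_congr rfl fun k _ => by ring

lemma bddBelow_approx (s : ℝ≥0∞) (m : ℕ) (g : ℝ → ℝ) :
    BddBelow ((fun t : ℝ → ℝ => normLs s (fun x => g x - t x)) '' trigPoly (m - 1)) :=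
  ⟨0, by rintro _ ⟨t, -, rfl⟩; exact normLs_nonneg _ _⟩

lemma bestApprox_le {m : ℕ} {g T : ℝ → ℝ} (hT : T ∈ trigPoly (m - 1)) :
    bestApprox s m g ≤ normLs s (fun x => g x - T x) :=
  csInf_le (bddBelow_approx s m g) ⟨T, hT, rfl⟩

lemma le_bestApprox {m : ℕ} {g : ℝ → ℝ} {r : ℝ}
    (h : ∀ T ∈ trigPoly (m - 1), r ≤ normLs s (fun x => g x - T x)) : r ≤ bestApprox s m g := by
  refine le_csInf ⟨_, _, const_mem_trigPoly _ 0, rfl⟩ ?_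
  rintro _ ⟨T, hT, rfl⟩
  exact h T hT

lemma bestApprox_nonneg (s : ℝ≥0∞) (m : ℕ) (g : ℝ → ℝ) : 0 ≤ bestApprox s m g :=
  le_bestApprox fun _ _ => normLs_nonneg _ _

lemma bestApprox_const_mul_le (s : ℝ≥0∞) (m : ℕ) (g : ℝ → ℝ) {d : ℝ} (hd : 0 < d) :
    bestApprox s m (fun x => d * g x) ≤ d * bestApprox s m g := by
  rw [← div_le_iff₀' hd]
  refine le_bestApprox fun T hT => ?_
  rw [div_le_iff₀' hd]
  refine (bestApprox_le (const_mul_mem_trigPoly hT d)).trans (le_of_eq ?_)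
  conv_rhs => rw [← abs_of_pos hd, ← normLs_const_mul]
  congr 1; ext x; ring

/-- The reverse inequality is the one-sided bound for the factor 1/d, applied to d·g. -/
lemma bestApprox_const_mul (s : ℝ≥0∞) (m : ℕ) (g : ℝ → ℝ) {d : ℝ} (hd : 0 < d) :
    bestApprox s m (fun x => d * g x) = d * bestApprox s m g := by
  refine le_antisymm (bestApprox_const_mul_le s m g hd) ?_
  have := bestApprox_const_mul_le s m (fun x => d * g x) (inv_pos.2 hd)
  simp only [inv_mul_cancel_left₀ hd.ne'] at this
  rwa [le_inv_mul_iff₀ hd] at this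

/-- The kernel has no harmonics of order at most n-p, so Φ may be replaced by Φ - T for every
admissible T. Hölder's inequality and the infimum over T then give the bound. -/
lemma abs_integral_mul_vpKernel_le {s' : ℝ≥0∞} (hs : Summable ψ)
    (hss : s⁻¹ + s'⁻¹ = 1) {Φ : ℝ → ℝ} (h1 : Integrable Φ periodMeasure) (h2 : MemLs s Φ)
    (β : ℝ) (n p : ℕ) (x : ℝ) :
    |∫ t, Φ t * vpKernel ψ β n p (x - t) ∂periodMeasure| ≤
      normLs s' (vpKernel ψ β n p) * bestApprox s (n - p + 1) Φ := by
  have hK := continuous_vpKernel hs β n p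
  have hKx : Continuous fun t => vpKernel ψ β n p (x - t) := by fun_prop
  have key : ∀ T ∈ trigPoly (n - p + 1 - 1),
      |∫ t, Φ t * vpKernel ψ β n p (x - t) ∂periodMeasure| ≤
        normLs s' (vpKernel ψ β n p) * normLs s (fun x => Φ x - T x) := by
    intro T hT
    have hTc := continuous_of_mem_trigPoly hT
    have h3 : ∫ t, Φ t * vpKernel ψ β n p (x - t) ∂periodMeasure =
        ∫ t, (Φ t - T t) * vpKernel ψ β n p (x - t) ∂periodMeasure := by
      simp only [sub_mul]
      rw [integral_sub (integrable_mul_of_continuous h1 hKx)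
        (integrable_of_continuous (g := fun t => T t * vpKernel ψ β n p (x - t)) (hTc.mul hKx)), integral_trigPoly_mul_vpKernel hs β n p x hT,
        sub_zero]
    rw [h3]
    refine (abs_integral_mul_le hss (f := fun t => Φ t - T t)
      (h2.2.sub (memLp_of_continuous hTc s)) (memLp_of_continuous hKx s')).trans (le_of_eq ?_)
    rw [normLs_comp_sub_left hK (periodic_vpKernel ψ β n p), mul_comm]
  -- The infimum is reached by dividing by the kernel's norm, so a vanishing norm is treated apart.
  rcases (normLs_nonneg s' (vpKernel ψ β n p)).eq_or_lt with h0 | h0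
  · have := key _ (const_mem_trigPoly _ 0)
    rw [← h0, zero_mul] at this ⊢
    exact this
  · rw [← div_le_iff₀' h0]
    refine le_bestApprox fun T hT => ?_
    rw [div_le_iff₀' h0]
    exact key T hT

lemma abs_vpDeviation_le {s' : ℝ≥0∞} (hψ : ∀ k : ℕ, 1 ≤ k → 0 < ψ k) (hs : Summable ψ)
    (hss : s⁻¹ + s'⁻¹ = 1) (h : MemCPsiBeta ψ β s f φ) {n p : ℕ} (hp : 1 ≤ p) (hpn : p ≤ n)
    (x : ℝ) :
    |vpDeviation n p f x| ≤
      (1 / Real.pi) * normLs s' (vpKernel ψ β n p) * bestApprox s (n - p + 1) φ := by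
  rw [vpDeviation_eq_integral hψ hs h hp hpn, abs_mul, abs_of_pos (by positivity : 0 < 1 / Real.pi),
    mul_assoc]
  exact mul_le_mul_of_nonneg_left
    (abs_integral_mul_vpKernel_le hs hss h.2.1.integrable h.2.2 β n p x) (by positivity)

lemma normC_vpDeviation_le {s' : ℝ≥0∞} (hψ : ∀ k : ℕ, 1 ≤ k → 0 < ψ k) (hs : Summable ψ)
    (hss : s⁻¹ + s'⁻¹ = 1) (h : MemCPsiBeta ψ β s f φ) {n p : ℕ} (hp : 1 ≤ p) (hpn : p ≤ n) :
    normC (vpDeviation n p f) ≤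
      (1 / Real.pi) * normLs s' (vpKernel ψ β n p) * bestApprox s (n - p + 1) φ :=
  ciSup_le fun x => abs_vpDeviation_le hψ hs hss h hp hpn x

lemma abs_vpDeviation_le_normC {s' : ℝ≥0∞} (hψ : ∀ k : ℕ, 1 ≤ k → 0 < ψ k) (hs : Summable ψ)
    (hss : s⁻¹ + s'⁻¹ = 1) (h : MemCPsiBeta ψ β s f φ) {n p : ℕ} (hp : 1 ≤ p) (hpn : p ≤ n)
    (x : ℝ) : |vpDeviation n p f x| ≤ normC (vpDeviation n p f) :=
  le_ciSup (f := fun x => |vpDeviation n p f x|)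
    ⟨_, by rintro _ ⟨y, rfl⟩; exact abs_vpDeviation_le hψ hs hss h hp hpn y⟩ x

end

/-! ### Extremal functions in Hölder's inequality -/

lemma normLs_top_le_of_ae_bound {f : ℝ → ℝ} {D : ℝ} (hD : 0 ≤ D)
    (h : ∀ᵐ t ∂periodMeasure, |f t| ≤ D) : normLs ∞ f ≤ D := by
  have h1 := eLpNorm_le_of_ae_bound (p := ∞) (μ := periodMeasure) (f := f) (C := D) h
  simp only [ENNReal.toReal_top, inv_zero, ENNReal.rpow_zero, one_mul] at h1
  have h2 := ENNReal.toReal_mono ENNReal.ofReal_ne_top h1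
  rwa [ENNReal.toReal_ofReal hD] at h2

lemma memLp_of_bound {f : ℝ → ℝ} (hf : Measurable f) {M : ℝ} (hM : ∀ x, |f x| ≤ M) (u : ℝ≥0∞) :
    MemLp f u periodMeasure :=
  MemLp.of_bound hf.aestronglyMeasurable M (.of_forall hM)

/-- `Φ` is a bounded measurable `2π`-periodic function in the unit ball of `L_s`. -/
structure IsTestFunction (s : ℝ≥0∞) (Φ : ℝ → ℝ) : Prop where
  periodic : Function.Periodic Φ (2 * Real.pi)
  measurable : Measurable Φ
  bounded : ∃ M, ∀ x, |Φ x| ≤ M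
  normLs_le_one : normLs s Φ ≤ 1

section
variable {g : ℝ → ℝ}

lemma measurable_realSign : Measurable Real.sign := by
  unfold Real.sign
  exact Measurable.ite measurableSet_Iio measurable_const
    (Measurable.ite measurableSet_Ioi measurable_const measurable_const)

lemma abs_realSign_le (x : ℝ) : |Real.sign x| ≤ 1 := by
  rcases Real.sign_apply_eq x with h | h | h <;> rw [h] <;> simp

lemma realSign_mul_self (x : ℝ) : Real.sign x * x = |x| := by
  rcases lt_trichotomy x 0 with h | h | h
  · rw [Real.sign_of_neg h, abs_of_neg h]; ring
  · simp [h]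
  · rw [Real.sign_of_pos h, abs_of_pos h, one_mul]

lemma exists_test_one (hg : Continuous g) (hp : Function.Periodic g (2 * Real.pi)) :
    ∃ Φ, IsTestFunction ∞ Φ ∧ normLs 1 g ≤ ∫ t, Φ t * g t ∂periodMeasure := by
  refine ⟨fun t => Real.sign (g t), ⟨fun x => by simp only [hp x],
    measurable_realSign.comp hg.measurable, ⟨1, fun x => abs_realSign_le _⟩,
    normLs_top_le_of_ae_bound zero_le_one (.of_forall fun x => abs_realSign_le _)⟩, ?_⟩
  rw [normLs_one (memLp_of_continuous hg 1)]
  simp_rw [realSign_mul_self]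
  exact le_rfl

/-- The supremum norm need not be attained by pairing with an L₁ function. The sign of g spread
uniformly over the set where |g| ≥ (1-η)‖g‖_∞, which has positive measure, loses only the factor
1-η. -/
lemma exists_test_top (hg : Continuous g) (hp : Function.Periodic g (2 * Real.pi))
    (hpos : 0 < normLs ∞ g) {η : ℝ} (hη : 0 < η) (hη1 : η < 1) :
    ∃ Φ, IsTestFunction 1 Φ ∧ (1 - η) * normLs ∞ g ≤ ∫ t, Φ t * g t ∂periodMeasure := by
  set N := normLs ∞ g
  let A : Set ℝ := {x | (1 - η) * N ≤ |g x|}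
  have hA : MeasurableSet A := (isClosed_le continuous_const hg.abs).measurableSet
  have hA0 : periodMeasure A ≠ 0 := by
    intro h
    have h1 : ∀ᵐ x ∂periodMeasure, |g x| ≤ (1 - η) * N := by
      have : ∀ᵐ x ∂periodMeasure, x ∉ A := measure_eq_zero_iff_ae_notMem.1 h
      filter_upwards [this] with x hx
      exact (not_le.1 hx).le
    have := normLs_top_le_of_ae_bound (mul_nonneg (by linarith) hpos.le) h1
    have h3 := mul_pos hη hpos
    change N ≤ _ at this
    linarith
  set a := (periodMeasure A).toReal
  have ha : 0 < a := ENNReal.toReal_pos hA0 (measure_ne_top _ _)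
  have hmeas : Measurable fun t => A.indicator (fun x => a⁻¹ * Real.sign (g x)) t :=
    (measurable_const.mul (measurable_realSign.comp hg.measurable)).indicator hA
  have hbound : ∀ x, |A.indicator (fun x => a⁻¹ * Real.sign (g x)) x| ≤
      A.indicator (fun _ => a⁻¹) x := by
    intro x
    by_cases hx : x ∈ A
    · simp only [Set.indicator_of_mem hx, abs_mul, abs_of_pos (inv_pos.2 ha)]
      exact mul_le_of_le_one_right (inv_pos.2 ha).le (abs_realSign_le _)
    · simp [Set.indicator_of_notMem hx]
  have hb2 : ∀ x, |A.indicator (fun x => a⁻¹ * Real.sign (g x)) x| ≤ a⁻¹ := fun x =>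
    (hbound x).trans (Set.indicator_le_self' (fun _ _ => (inv_pos.2 ha).le) x)
  refine ⟨A.indicator (fun x => a⁻¹ * Real.sign (g x)), ⟨?_, hmeas, ⟨a⁻¹, hb2⟩, ?_⟩, ?_⟩
  · intro x
    have : x + 2 * Real.pi ∈ A ↔ x ∈ A := by
      change _ ≤ |g _| ↔ _ ≤ |g _|
      rw [hp x]
    by_cases hx : x ∈ A
    · rw [Set.indicator_of_mem hx, Set.indicator_of_mem (this.2 hx), hp x]
    · rw [Set.indicator_of_notMem hx, Set.indicator_of_notMem (fun h => hx (this.1 h))]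
  · rw [normLs_one (memLp_of_bound hmeas hb2 1)]
    have h1 : ∫ t, A.indicator (fun _ => a⁻¹) t ∂periodMeasure = 1 := by
      rw [integral_indicator hA]
      simp only [integral_const, smul_eq_mul, measureReal_restrict_apply_univ]
      exact mul_inv_cancel₀ ha.ne'
    rw [← h1]
    refine integral_mono (memLp_one_iff_integrable.1 (memLp_of_bound hmeas hb2 1)).abs
      ((integrable_const _).indicator hA) hbound
  · have h1 : ∫ t, A.indicator (fun _ => a⁻¹ * ((1 - η) * N)) t ∂periodMeasure = (1 - η) * N := by
      rw [integral_indicator hA]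
      simp only [integral_const, smul_eq_mul, measureReal_restrict_apply_univ]
      exact mul_inv_cancel_left₀ ha.ne' _
    rw [← h1]
    refine integral_mono ((integrable_const _).indicator hA)
      (integrable_mul_of_continuous (memLp_one_iff_integrable.1 (memLp_of_bound hmeas hb2 1)) hg) ?_
    intro x
    dsimp only
    by_cases hx : x ∈ A
    · rw [Set.indicator_of_mem hx, Set.indicator_of_mem hx, mul_assoc, realSign_mul_self]
      exact mul_le_mul_of_nonneg_left hx (inv_pos.2 ha).le
    · rw [Set.indicator_of_notMem hx, Set.indicator_of_notMem hx, zero_mul]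

/-- The equality case of Hölder: Φ = sign(g)|g|^{r-1}/‖g‖^{r-1} with r = s', where conjugacy gives
(r-1)s = r. -/
lemma exists_test_of_lt (hg : Continuous g) (hp : Function.Periodic g (2 * Real.pi))
    {s s' : ℝ≥0∞} (hss : s⁻¹ + s'⁻¹ = 1) (h1 : 1 < s') (ht : s' ≠ ∞)
    (hpos : 0 < normLs s' g) :
    ∃ Φ, IsTestFunction s Φ ∧ normLs s' g ≤ ∫ t, Φ t * g t ∂periodMeasure := by
  set N := normLs s' g with hN
  set r := s'.toReal with hr
  have hr1 : 1 < r := by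
    have := (ENNReal.toReal_lt_toReal ENNReal.one_ne_top ht).2 h1
    simpa using this
  have hs0 : s ≠ 0 := by
    rintro rfl
    simp at hss
  have hst : s ≠ ∞ := by
    rintro rfl
    simp only [ENNReal.inv_top, zero_add, ENNReal.inv_eq_one] at hss
    exact h1.ne' hss
  have hσ : s.toReal⁻¹ + r⁻¹ = 1 := by
    have := congrArg ENNReal.toReal hss
    rwa [ENNReal.toReal_add (ENNReal.inv_ne_top.2 hs0)
      (ENNReal.inv_ne_top.2 (zero_lt_one.trans h1).ne'), ENNReal.toReal_inv, ENNReal.toReal_inv,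
      ENNReal.toReal_one] at this
  have hσ0 : 0 < s.toReal := ENNReal.toReal_pos hs0 hst
  have hmul : (r - 1) * s.toReal = r := by
    have hr0 : r ≠ 0 := by positivity
    field_simp at hσ
    linarith
  have hgM := abs_le_normLs_top hg hp
  set M := normLs ∞ g
  set d := (N ^ (r - 1))⁻¹ with hd
  have hdpos : 0 < d := by positivity
  let Φ : ℝ → ℝ := fun t => d * (Real.sign (g t) * |g t| ^ (r - 1))
  have habs : ∀ t, |Φ t| = d * |g t| ^ (r - 1) := by
    intro t
    simp only [Φ]
    rw [abs_mul, abs_mul, abs_of_pos hdpos, abs_of_nonneg (Real.rpow_nonneg (abs_nonneg (g t)) _)]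
    rcases eq_or_ne (g t) 0 with h0 | h0
    · rw [h0, abs_zero, Real.zero_rpow (by linarith)]; simp
    · have : |Real.sign (g t)| = 1 := by
        rcases lt_or_gt_of_ne h0 with h | h
        · rw [Real.sign_of_neg h]; simp
        · rw [Real.sign_of_pos h]; simp
      rw [this, one_mul]
  have hmeas : Measurable Φ := by
    have := measurable_realSign.comp hg.measurable
    exact measurable_const.mul (this.mul (hg.abs.measurable.pow_const _))
  have hb : ∀ x, |Φ x| ≤ d * M ^ (r - 1) := by
    intro x
    rw [habs]
    exact mul_le_mul_of_nonneg_left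
      (Real.rpow_le_rpow (abs_nonneg _) (hgM x) (by linarith)) hdpos.le
  have hNr := normLs_rpow (zero_lt_one.trans h1).ne' ht (memLp_of_continuous hg s')
  rw [← hr, ← hN] at hNr
  refine ⟨Φ, ⟨fun x => by simp only [Φ, hp x], hmeas, ⟨_, hb⟩, ?_⟩, ?_⟩
  · have h2 := normLs_rpow hs0 hst (memLp_of_bound hmeas hb s)
    have h3 : ∀ t, |Φ t| ^ s.toReal = (N ^ r)⁻¹ * |g t| ^ r := by
      intro t
      rw [habs, Real.mul_rpow hdpos.le (by positivity), ← Real.rpow_mul (abs_nonneg _), hmul, hd,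
        Real.inv_rpow (by positivity), ← Real.rpow_mul hpos.le, hmul]
    simp_rw [h3] at h2
    rw [integral_const_mul, ← hNr, inv_mul_cancel₀ (by positivity)] at h2
    have h4 := normLs_nonneg s Φ
    by_contra! hlt
    have := Real.one_lt_rpow hlt hσ0
    linarith
  · have h3 : ∀ t, Φ t * g t = d * |g t| ^ r := by
      intro t
      have : Φ t * g t = d * (|g t| ^ (r - 1) * (Real.sign (g t) * g t)) := by simp only [Φ]; ring
      rw [this, realSign_mul_self]
      rcases (abs_nonneg (g t)).eq_or_lt with h0 | h0
      · rw [← h0, Real.zero_rpow (by linarith), Real.zero_rpow (by linarith)]; simp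
      · rw [Real.rpow_sub_one h0.ne', div_mul_cancel₀ _ h0.ne']
    simp_rw [h3]
    rw [integral_const_mul, ← hNr, hd, Real.rpow_sub_one hpos.ne']
    have : N ^ r ≠ 0 := by positivity
    field_simp
    exact le_rfl

lemma exists_test (hg : Continuous g) (hp : Function.Periodic g (2 * Real.pi))
    {s s' : ℝ≥0∞} (hss : s⁻¹ + s'⁻¹ = 1) (hpos : 0 < normLs s' g) {η : ℝ} (hη0 : 0 ≤ η)
    (hη1 : η < 1) (hη : s = 1 → 0 < η) :
    ∃ Φ, IsTestFunction s Φ ∧ (1 - η) * normLs s' g ≤ ∫ t, Φ t * g t ∂periodMeasure := by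
  have hs1 : 1 ≤ s' := by
    rw [← ENNReal.inv_le_one, ← hss]; exact le_add_self
  have hle : (1 - η) * normLs s' g ≤ normLs s' g := mul_le_of_le_one_left hpos.le (by linarith)
  rcases eq_or_ne s' ∞ with rfl | ht
  · have : s = 1 := by simpa using hss
    subst this
    exact exists_test_top hg hp hpos (hη rfl) hη1
  rcases hs1.eq_or_lt with rfl | h1
  · have hs : s = ∞ := by
      rw [inv_one] at hss
      have : s⁻¹ = 0 := by
        have h2 : s⁻¹ + 1 = 0 + 1 := by rw [hss, zero_add]
        exact (ENNReal.add_left_inj ENNReal.one_ne_top).1 h2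
      simpa using this
    subst hs
    obtain ⟨Φ, h1, h2⟩ := exists_test_one hg hp
    exact ⟨Φ, h1, hle.trans h2⟩
  · obtain ⟨Φ, h1, h2⟩ := exists_test_of_lt hg hp hss h1 ht hpos
    exact ⟨Φ, h1, hle.trans h2⟩

end

/-! ### Sharpness of the upper estimate -/

section
variable {ψ : ℕ → ℝ} {β : ℝ} {s s' : ℝ≥0∞}

/-- A test function for the reflected kernel, made mean-free and rescaled, serves as the derivative
of F; the deviation of F at 0 is its pairing with that kernel. -/
lemma exists_extremal (hψ : ∀ k : ℕ, 1 ≤ k → 0 < ψ k) (hs : Summable ψ)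
    (hss : s⁻¹ + s'⁻¹ = 1) {n p : ℕ} (hp : 1 ≤ p) (hpn : p ≤ n)
    (hpos : 0 < normLs s' (vpKernel ψ β n p)) {e : ℝ} (he : 0 < e)
    {η : ℝ} (hη0 : 0 ≤ η) (hη1 : η < 1) (hη : s = 1 → 0 < η) :
    ∃ F Φ, MemCPsiBeta ψ β s F Φ ∧ bestApprox s (n - p + 1) Φ = e ∧
      (1 - η) * ((1 / Real.pi) * normLs s' (vpKernel ψ β n p)) * e ≤
        normC (vpDeviation n p F) := by
  have hK := continuous_vpKernel hs β n p
  have hKp := periodic_vpKernel ψ β n p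
  have hnorm := normLs_comp_sub_left hK hKp s' 0
  have hp' : Function.Periodic (fun t => vpKernel ψ β n p (0 - t)) (2 * Real.pi) := by
    intro t; dsimp only; rw [← hKp (0 - (t + 2 * Real.pi))]; ring_nf
  obtain ⟨Φ₀, hΦ₀, hI⟩ := exists_test (g := fun t => vpKernel ψ β n p (0 - t)) (by fun_prop) hp' hss
    (hnorm ▸ hpos) hη0 hη1 hη
  rw [hnorm] at hI
  set N := normLs s' (vpKernel ψ β n p)
  obtain ⟨M, hM⟩ := hΦ₀.bounded
  have hint : Integrable Φ₀ periodMeasure :=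
    memLp_one_iff_integrable.1 (memLp_of_bound hΦ₀.measurable hM 1)
  -- This is the mean value. Subtracting it makes the function admissible as a derivative and leaves
  -- the pairing unchanged, since the kernel is orthogonal to constants.
  set d := fourierA Φ₀ 0 / 2 with hd
  have hmem : ∀ (c : ℝ) (u : ℝ≥0∞), MemLs u (fun t => c * (Φ₀ t - d)) := by
    refine fun c u => ⟨fun t => by simp only [hΦ₀.periodic t], ?_⟩
    exact ((memLp_of_bound hΦ₀.measurable hM u).sub (memLp_of_continuous continuous_const u)).const_mul c
  have h0 : ∀ c : ℝ, fourierA (fun t => c * (Φ₀ t - d)) 0 = 0 := by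
    intro c
    have h1 : fourierA Φ₀ 0 = 2 * d := by rw [hd]; ring
    rw [fourierA_eq] at h1 ⊢
    simp only [Nat.cast_zero, zero_mul, Real.cos_zero, mul_one] at h1 ⊢
    rw [integral_const_mul, integral_sub hint (integrable_const _), integral_const,
      Measure.real, periodMeasure_univ, ENNReal.toReal_ofReal Real.two_pi_pos.le, smul_eq_mul]
    have : Real.pi ≠ 0 := Real.pi_ne_zero
    field_simp at h1
    rw [h1]; field_simp; ring
  have hIc : ∀ c : ℝ, ∫ t, c * (Φ₀ t - d) * vpKernel ψ β n p (0 - t) ∂periodMeasure =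
      c * ∫ t, Φ₀ t * vpKernel ψ β n p (0 - t) ∂periodMeasure := by
    intro c
    simp only [mul_assoc]
    rw [integral_const_mul]
    simp only [sub_mul]
    rw [integral_sub (integrable_mul_of_continuous hint (by fun_prop))
      (integrable_of_continuous (by fun_prop)),
      integral_trigPoly_mul_vpKernel hs β n p 0 (const_mem_trigPoly _ d), sub_zero]
  set I := ∫ t, Φ₀ t * vpKernel ψ β n p (0 - t) ∂periodMeasure
  have hIpos : 0 < I := (mul_pos (by linarith) hpos).trans_le hI
  have hE1 : bestApprox s (n - p + 1) (fun t => Φ₀ t - d) ≤ 1 := by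
    refine (bestApprox_le (const_mem_trigPoly _ (-d))).trans (le_trans (le_of_eq ?_)
      hΦ₀.normLs_le_one)
    congr 1; ext t; ring
  -- A function that pairs nontrivially with the kernel cannot have zero best approximation, by the
  -- upper estimate itself; this permits division by E.
  have hE0 : 0 < bestApprox s (n - p + 1) (fun t => Φ₀ t - d) := by
    have := abs_integral_mul_vpKernel_le hs hss (memLp_one_iff_integrable.1 (hmem 1 1).2) (hmem 1 s)
      β n p 0
    rw [hIc, one_mul, abs_of_pos hIpos] at this
    simp only [one_mul] at this
    exact (pos_iff_pos_of_mul_pos (hIpos.trans_le this)).1 hpos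
  set E := bestApprox s (n - p + 1) (fun t => Φ₀ t - d)
  have hc : 0 < e / E := by positivity
  obtain ⟨F, hF⟩ := exists_memCPsiBeta hψ hs β (hmem (e / E) 1) (hmem (e / E) s) (h0 _)
  refine ⟨F, _, hF, ?_, ?_⟩
  · rw [bestApprox_const_mul _ _ _ hc]
    exact div_mul_cancel₀ _ hE0.ne'
  · have h1 := vpDeviation_eq_integral hψ hs hF hp hpn 0
    rw [hIc] at h1
    have h2 := abs_vpDeviation_le_normC hψ hs hss hF hp hpn 0
    refine le_trans ?_ ((le_abs_self _).trans h2)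
    rw [h1]
    -- Because E ≤ 1, prescribing the best approximation e scales the test function by at least e,
    -- so the lower bound survives.
    have h3 : e ≤ e / E := by
      rw [le_div_iff₀ hE0]
      exact mul_le_of_le_one_right he.le hE1
    calc (1 - η) * (1 / Real.pi * N) * e = (1 / Real.pi) * (e * ((1 - η) * N)) := by ring
      _ ≤ (1 / Real.pi) * ((e / E) * I) := by
          refine mul_le_mul_of_nonneg_left ?_ (by positivity)
          exact mul_le_mul h3 hI (mul_nonneg (by linarith) hpos.le) hc.le

end

/-! ### The symbol and its modulus of continuity -/

/-- `(1 - w^p) / (1 - w)²`, the sum of `∑ min(j+1, p) w^j`, at `w = q e^{it}`. -/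
noncomputable def symbol (q : ℝ) (p : ℕ) (t : ℝ) : ℂ :=
  (1 - (q * Complex.exp (t * Complex.I)) ^ p) / (1 - q * Complex.exp (t * Complex.I)) ^ 2

/-- The coefficient min(j+1, p) counts the i < p with i ≤ j, so the series is a sum of p geometric
series starting at w^i. -/
lemma hasSum_min_mul_pow {w : ℂ} (hw : ‖w‖ < 1) (p : ℕ) :
    HasSum (fun j : ℕ => ((min (j + 1) p : ℕ) : ℂ) * w ^ j) ((1 - w ^ p) / (1 - w) ^ 2) := by
  have h1 : 1 - w ≠ 0 := by
    intro h
    have : w = 1 := (sub_eq_zero.1 h).symm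
    simp [this] at hw
  have h2 : ∀ i ∈ Finset.range p, HasSum (fun j : ℕ => if i ≤ j then w ^ j else 0)
      (w ^ i * (1 - w)⁻¹) := by
    intro i _
    rw [← hasSum_nat_add_iff' i, Finset.sum_eq_zero, sub_zero]
    · have := (hasSum_geometric_of_norm_lt_one hw).mul_left (w ^ i)
      refine (hasSum_congr fun j => ?_).1 this
      rw [if_pos (by omega), pow_add, mul_comm]
    · intro j hj
      rw [if_neg (by simpa using hj)]
  have h3 := hasSum_sum h2
  rw [← Finset.sum_mul, geom_sum_eq (fun h => h1 (by rw [h, sub_self]))] at h3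
  convert h3 using 1
  · ext j
    rw [← Finset.sum_filter, Finset.sum_const, nsmul_eq_mul]
    congr 2
    have : (Finset.range p).filter (fun i => i ≤ j) = Finset.range (min (j + 1) p) := by
      ext i; simp only [Finset.mem_filter, Finset.mem_range]; omega
    rw [this, Finset.card_range]
  · have h4 : w - 1 ≠ 0 := by rw [← neg_sub]; exact neg_ne_zero.2 h1
    field_simp
    ring

section
variable {q : ℝ}

lemma norm_ofReal_mul_exp (hq0 : 0 ≤ q) (t : ℝ) : ‖(q : ℂ) * Complex.exp (t * Complex.I)‖ = q := by
  rw [norm_mul, Complex.norm_exp_ofReal_mul_I, Complex.norm_real, mul_one, Real.norm_eq_abs,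
    abs_of_nonneg hq0]

lemma normSq_one_sub (ρ θ : ℝ) :
    Complex.normSq (1 - ρ * Complex.exp (θ * Complex.I)) = 1 - 2 * ρ * Real.cos θ + ρ ^ 2 := by
  rw [Complex.exp_mul_I, ← Complex.ofReal_cos, ← Complex.ofReal_sin]
  simp only [Complex.normSq_apply, Complex.sub_re, Complex.sub_im, Complex.mul_re, Complex.mul_im,
    Complex.add_re, Complex.add_im, Complex.ofReal_re, Complex.ofReal_im, Complex.one_re,
    Complex.one_im, Complex.I_re, Complex.I_im]
  linear_combination ρ ^ 2 * Real.sin_sq_add_cos_sq θ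

lemma one_sub_ne_zero (hq0 : 0 ≤ q) (hq1 : q < 1) (t : ℝ) :
    (1 : ℂ) - q * Complex.exp (t * Complex.I) ≠ 0 := by
  intro h
  have h1 := norm_ofReal_mul_exp hq0 t
  rw [← sub_eq_zero.1 h] at h1
  simp at h1
  linarith

lemma continuous_symbol (hq0 : 0 ≤ q) (hq1 : q < 1) (p : ℕ) : Continuous (symbol q p) := by
  unfold symbol
  exact Continuous.div (by fun_prop) (by fun_prop) fun t => pow_ne_zero _ (one_sub_ne_zero hq0 hq1 t)

lemma periodic_symbol (q : ℝ) (p : ℕ) : Function.Periodic (symbol q p) (2 * Real.pi) := by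
  intro t
  unfold symbol
  have : ((t + 2 * Real.pi : ℝ) : ℂ) * Complex.I = t * Complex.I + 2 * Real.pi * Complex.I := by
    push_cast; ring
  rw [this, Complex.exp_periodic (t * Complex.I)]

lemma norm_symbol (q : ℝ) (p : ℕ) (t : ℝ) :
    ‖symbol q p t‖ = Real.sqrt (1 - 2 * q ^ p * Real.cos (p * t) + q ^ (2 * p)) /
      (1 - 2 * q * Real.cos t + q ^ 2) := by
  unfold symbol
  rw [norm_div, norm_pow, ← Complex.normSq_eq_norm_sq, normSq_one_sub, mul_pow,
    ← Complex.exp_nat_mul]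
  have h := normSq_one_sub (q ^ p) (p * t)
  have h2 : ((p : ℂ) * (t * Complex.I)) = ((p * t : ℝ) : ℂ) * Complex.I := by push_cast; ring
  rw [Complex.norm_def, h2]
  push_cast at h ⊢
  rw [h, mul_comm 2 p, pow_mul]

lemma hasSum_symbol (hq0 : 0 ≤ q) (hq1 : q < 1) (p : ℕ) (t : ℝ) :
    HasSum (fun j : ℕ => ((min (j + 1) p : ℕ) : ℂ) * (q * Complex.exp (t * Complex.I)) ^ j)
      (symbol q p t) :=
  hasSum_min_mul_pow (by rwa [norm_ofReal_mul_exp hq0]) p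

lemma norm_exp_sub_exp_le (x y : ℝ) :
    ‖Complex.exp (x * Complex.I) - Complex.exp (y * Complex.I)‖ ≤ |x - y| := by
  have h1 : Complex.exp (x * Complex.I) - Complex.exp (y * Complex.I) =
      Complex.exp (y * Complex.I) * (Complex.exp (Complex.I * ((x - y : ℝ) : ℂ)) - 1) := by
    rw [mul_sub, ← Complex.exp_add, mul_one]
    congr 2; push_cast; ring
  rw [h1, norm_mul, Complex.norm_exp_ofReal_mul_I, one_mul]
  exact Real.norm_exp_I_mul_ofReal_sub_one_le

/-- Termwise, a shift by τ changes e^{ijt} by at most j|τ|. -/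
lemma norm_symbol_sub_le (hq0 : 0 ≤ q) (hq1 : q < 1) (p : ℕ) {S : ℝ}
    (hS : HasSum (fun j : ℕ => ((min (j + 1) p : ℕ) : ℝ) * (j * q ^ j)) S) (t τ : ℝ) :
    ‖symbol q p (t + τ) - symbol q p t‖ ≤ |τ| * S := by
  have h := (hasSum_symbol hq0 hq1 p (t + τ)).sub (hasSum_symbol hq0 hq1 p t)
  rw [← h.tsum_eq]
  refine tsum_of_norm_bounded (hS.mul_left |τ|) fun j => ?_
  rw [← mul_sub, norm_mul, mul_pow, mul_pow, ← mul_sub, norm_mul, ← Complex.exp_nat_mul,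
    ← Complex.exp_nat_mul]
  have e1 : (j : ℂ) * (((t + τ : ℝ) : ℂ) * Complex.I) = ((j * (t + τ) : ℝ) : ℂ) * Complex.I := by
    push_cast; ring
  have e2 : (j : ℂ) * ((t : ℂ) * Complex.I) = ((j * t : ℝ) : ℂ) * Complex.I := by
    push_cast; ring
  have h3 := norm_exp_sub_exp_le (j * (t + τ)) (j * t)
  have e3 : |(j : ℝ) * (t + τ) - j * t| = j * |τ| := by
    rw [← mul_sub, add_sub_cancel_left, abs_mul, Nat.abs_cast]
  rw [e1, e2, norm_pow, Complex.norm_real, Real.norm_eq_abs, abs_of_nonneg hq0,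
    Complex.norm_natCast]
  rw [e3] at h3
  calc _ ≤ ((min (j + 1) p : ℕ) : ℝ) * (q ^ j * (j * |τ|)) := by gcongr
    _ = _ := by ring

lemma summable_min_mul (hq0 : 0 ≤ q) (hq1 : q < 1) (p : ℕ) :
    Summable fun j : ℕ => ((min (j + 1) p : ℕ) : ℝ) * (j * q ^ j) := by
  have hn : ‖q‖ < 1 := by rwa [Real.norm_eq_abs, abs_of_nonneg hq0]
  refine Summable.of_nonneg_of_le (fun j => by positivity) (fun j => ?_)
    ((hasSum_coe_mul_geometric_of_norm_lt_one hn).summable.mul_left (p : ℝ))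
  gcongr
  exact min_le_right _ _

lemma tsum_min_one (hq0 : 0 ≤ q) (hq1 : q < 1) :
    ∑' j : ℕ, ((min (j + 1) 1 : ℕ) : ℝ) * (j * q ^ j) = q / (1 - q) ^ 2 := by
  have hn : ‖q‖ < 1 := by rwa [Real.norm_eq_abs, abs_of_nonneg hq0]
  rw [← tsum_coe_mul_geometric_of_norm_lt_one hn]
  congr 1; ext j
  rw [min_eq_right (by omega)]; simp

lemma hasSum_mul_succ (hq0 : 0 ≤ q) (hq1 : q < 1) :
    HasSum (fun j : ℕ => ((j : ℝ) + 1) * (j * q ^ j)) (2 * q / (1 - q) ^ 3) := by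
  have hn : ‖q‖ < 1 := by rwa [Real.norm_eq_abs, abs_of_nonneg hq0]
  have h := (hasSum_choose_mul_geometric_of_norm_lt_one 2 hn).mul_left (2 * q)
  rw [← hasSum_nat_add_iff' 1]
  simp only [Finset.range_one, Finset.sum_singleton, Nat.cast_zero, zero_mul, mul_zero, sub_zero]
  rw [mul_one_div] at h
  refine (hasSum_congr fun j => ?_).1 h
  have : ((Nat.choose (j + 2) 2 : ℕ) : ℝ) = (j + 2) * (j + 1) / 2 := by
    rw [Nat.cast_choose_two]; push_cast; ring
  rw [this]; push_cast; ring

lemma tsum_min_le (hq0 : 0 ≤ q) (hq1 : q < 1) (p : ℕ) :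
    ∑' j : ℕ, ((min (j + 1) p : ℕ) : ℝ) * (j * q ^ j) ≤ 2 * q / (1 - q) ^ 3 := by
  rw [← (hasSum_mul_succ hq0 hq1).tsum_eq]
  refine (summable_min_mul hq0 hq1 p).tsum_le_tsum (fun j => ?_) (hasSum_mul_succ hq0 hq1).summable
  gcongr
  exact_mod_cast min_le_left _ _

/-- `(2π)⁻¹ ∫ F(e^{it}) dt = F(0)` for `F` analytic on the closed unit disc. -/
lemma integral_exp_eq {F : ℂ → ℂ} {U : Set ℂ} (hF : DifferentiableOn ℂ F U)
    (hsub : Metric.closedBall 0 1 ⊆ U) :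
    ∫ t : ℝ, F (Complex.exp (t * Complex.I)) ∂periodMeasure = 2 * Real.pi * F 0 := by
  have h1 : DiffContOnCl ℂ F (Metric.ball 0 |(1 : ℝ)|) := by
    rw [abs_one]
    refine DifferentiableOn.diffContOnCl_ball hF ?_
    exact hsub
  have h := h1.circleAverage
  rw [Real.circleAverage_def] at h
  simp only [circleMap, Complex.ofReal_one, one_mul, zero_add] at h
  rw [integral_periodMeasure, ← h, Complex.real_smul]
  rw [Complex.ofReal_inv, Complex.ofReal_mul, Complex.ofReal_ofNat, mul_inv_cancel_left₀]
  simp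

lemma closedBall_subset (hq0 : 0 ≤ q) (hq1 : q < 1) :
    Metric.closedBall 0 1 ⊆ {z : ℂ | 1 - q * z ≠ 0} := by
  intro z hz h
  rw [Metric.mem_closedBall, dist_zero_right] at hz
  have h1 : ‖(q : ℂ) * z‖ = 1 := by rw [← sub_eq_zero.1 h, norm_one]
  rw [norm_mul, Complex.norm_real, Real.norm_eq_abs, abs_of_nonneg hq0] at h1
  nlinarith [norm_nonneg z]

/-- The integrand is the boundary value of a function analytic on the closed disc that vanishes at 0
because m ≠ 0; the mean value property applies. -/
lemma integral_symbol_sq (hq0 : 0 ≤ q) (hq1 : q < 1) (p : ℕ) {m : ℕ} (hm : m ≠ 0) :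
    ∫ t : ℝ, (symbol q p t * Complex.exp (t * Complex.I) ^ m) ^ 2 ∂periodMeasure = 0 := by
  have h := integral_exp_eq (F := fun z => ((1 - (q * z) ^ p) / (1 - q * z) ^ 2 * z ^ m) ^ 2)
    (by
      refine DifferentiableOn.pow (DifferentiableOn.mul (DifferentiableOn.div (by fun_prop)
        (by fun_prop) fun z hz => pow_ne_zero _ hz) (by fun_prop)) 2) (closedBall_subset hq0 hq1)
  simpa [hm, symbol] using h

/-- The Poisson kernel is the real part of (1+w)/(1-w), whose mean is its value at the centre. -/
lemma integral_poisson (hq0 : 0 ≤ q) (hq1 : q < 1) :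
    ∫ t : ℝ, (1 - 2 * q * Real.cos t + q ^ 2)⁻¹ ∂periodMeasure = 2 * Real.pi / (1 - q ^ 2) := by
  have h := integral_exp_eq (F := fun z => (1 + q * z) / (1 - q * z))
    (DifferentiableOn.div (by fun_prop) (by fun_prop) fun z hz => hz)
    (closedBall_subset hq0 hq1)
  have hq2 : 0 < 1 - q ^ 2 := by nlinarith
  have hre : ∀ t : ℝ, ((1 + q * Complex.exp (t * Complex.I)) /
      (1 - q * Complex.exp (t * Complex.I))).re =
      (1 - q ^ 2) * (1 - 2 * q * Real.cos t + q ^ 2)⁻¹ := by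
    intro t
    rw [Complex.div_re, normSq_one_sub, Complex.exp_mul_I, ← Complex.ofReal_cos,
      ← Complex.ofReal_sin]
    simp only [Complex.sub_re, Complex.sub_im, Complex.mul_re, Complex.mul_im,
      Complex.add_re, Complex.add_im, Complex.ofReal_re, Complex.ofReal_im, Complex.one_re,
      Complex.one_im, Complex.I_re, Complex.I_im]
    rw [div_eq_mul_inv, div_eq_mul_inv]
    linear_combination (-(q ^ 2) * (1 - 2 * q * Real.cos t + q ^ 2)⁻¹) * Real.sin_sq_add_cos_sq t
  have hint : Integrable (fun t : ℝ => (1 + q * Complex.exp (t * Complex.I)) /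
      (1 - q * Complex.exp (t * Complex.I))) periodMeasure := by
    have hc : Continuous (fun t : ℝ => (1 + q * Complex.exp (t * Complex.I)) /
      (1 - q * Complex.exp (t * Complex.I))) :=
      Continuous.div (by fun_prop) (by fun_prop) fun t => one_sub_ne_zero hq0 hq1 t
    exact hc.integrableOn_Ioc
  have h2 := congrArg Complex.re h
  rw [← RCLike.re_eq_complex_re, ← integral_re hint] at h2
  simp only [RCLike.re_eq_complex_re, hre] at h2
  rw [integral_const_mul] at h2
  have h3 : (2 * Real.pi * ((1 + q * 0) / (1 - q * 0)) : ℂ).re = 2 * Real.pi := by simp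
  rw [h3] at h2
  rw [eq_div_iff hq2.ne', mul_comm]; exact h2

/-- For p = 1 the symbol is 1/(1-w), and the product of two reciprocals is split by ab ≤ (a²+b²)/2.
Integrating the resulting Poisson kernels costs one power of 1/(1-q) rather than two. -/
lemma norm_symbol_one_sub_le (hq0 : 0 ≤ q) (hq1 : q < 1) (t τ : ℝ) :
    ‖symbol q 1 (t + τ) - symbol q 1 t‖ ≤ q * |τ| / 2 *
      ((1 - 2 * q * Real.cos (t + τ) + q ^ 2)⁻¹ + (1 - 2 * q * Real.cos t + q ^ 2)⁻¹) := by
  have hz := one_sub_ne_zero hq0 hq1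
  have h1 : symbol q 1 (t + τ) - symbol q 1 t =
      q * (Complex.exp ((t + τ : ℝ) * Complex.I) - Complex.exp (t * Complex.I)) *
        ((1 - q * Complex.exp ((t + τ : ℝ) * Complex.I))⁻¹ *
        (1 - q * Complex.exp (t * Complex.I))⁻¹) := by
    unfold symbol
    have a1 := hz (t + τ)
    have a2 := hz t
    generalize Complex.exp ((t + τ : ℝ) * Complex.I) = x at *
    generalize Complex.exp ((t : ℂ) * Complex.I) = y at *
    field_simp
    ring
  rw [← normSq_one_sub, ← normSq_one_sub, Complex.normSq_eq_norm_sq, Complex.normSq_eq_norm_sq, h1,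
    norm_mul, norm_mul, norm_mul, norm_inv, norm_inv, Complex.norm_real, Real.norm_eq_abs,
    abs_of_nonneg hq0, ← inv_pow, ← inv_pow]
  set a := ‖1 - (q : ℂ) * Complex.exp ((t + τ : ℝ) * Complex.I)‖⁻¹
  set b := ‖1 - (q : ℂ) * Complex.exp (t * Complex.I)‖⁻¹
  have ha : 0 ≤ a := by positivity
  have hb : 0 ≤ b := by positivity
  have h2 := norm_exp_sub_exp_le (t + τ) t
  rw [add_sub_cancel_left] at h2
  calc _ ≤ q * |τ| * (a * b) := by gcongr
    _ ≤ q * |τ| * ((a ^ 2 + b ^ 2) / 2) := by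
        refine mul_le_mul_of_nonneg_left ?_ (by positivity)
        nlinarith [sq_nonneg (a - b)]
    _ = _ := by ring

end

/-! ### Norms of waves: averaging over the phase -/

/-- `Re (G(t) e^{i(mt + θ)})` for the symbol `G`. -/
noncomputable def wave (q : ℝ) (p m : ℕ) (θ t : ℝ) : ℝ :=
  (symbol q p t * Complex.exp ((m * t + θ : ℝ) * Complex.I)).re

section
variable {q : ℝ} {u : ℝ≥0∞}

lemma continuous_wave_uncurry (hq0 : 0 ≤ q) (hq1 : q < 1) (p m : ℕ) :
    Continuous fun x : ℝ × ℝ => wave q p m x.1 x.2 := by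
  have := continuous_symbol hq0 hq1 p
  unfold wave
  fun_prop

lemma continuous_wave (hq0 : 0 ≤ q) (hq1 : q < 1) (p m : ℕ) (θ : ℝ) :
    Continuous (wave q p m θ) := by
  have := continuous_symbol hq0 hq1 p
  unfold wave
  fun_prop

lemma periodic_wave (q : ℝ) (p m : ℕ) (θ : ℝ) : Function.Periodic (wave q p m θ) (2 * Real.pi) := by
  intro t
  unfold wave
  rw [periodic_symbol q p t]
  have : ((m * (t + 2 * Real.pi) + θ : ℝ) : ℂ) * Complex.I =
      ((m * t + θ : ℝ) : ℂ) * Complex.I + m * (2 * Real.pi * Complex.I) := by push_cast; ring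
  rw [this, Complex.exp_periodic.nat_mul m]

lemma wave_eq_norm_mul_cos (q : ℝ) (p m : ℕ) (θ t : ℝ) :
    wave q p m θ t = ‖symbol q p t‖ * Real.cos (θ + (m * t + (symbol q p t).arg)) := by
  unfold wave
  conv_lhs => rw [← Complex.norm_mul_exp_arg_mul_I (symbol q p t)]
  rw [mul_assoc, ← Complex.exp_add, ← add_mul, ← Complex.ofReal_add, Complex.re_ofReal_mul,
    Complex.exp_ofReal_mul_I_re]
  congr 2; ring

lemma abs_wave_le (q : ℝ) (p m : ℕ) (θ t : ℝ) : |wave q p m θ t| ≤ ‖symbol q p t‖ := by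
  rw [wave_eq_norm_mul_cos, abs_mul, abs_norm]
  exact mul_le_of_le_one_right (norm_nonneg _) (Real.abs_cos_le_one _)

lemma continuous_norm_symbol (hq0 : 0 ≤ q) (hq1 : q < 1) (p : ℕ) :
    Continuous fun t => ‖symbol q p t‖ := (continuous_symbol hq0 hq1 p).norm

lemma periodic_norm_symbol (q : ℝ) (p : ℕ) :
    Function.Periodic (fun t => ‖symbol q p t‖) (2 * Real.pi) := fun t => by
  simp only [periodic_symbol q p t]

lemma norm_symbol_le_top (hq0 : 0 ≤ q) (hq1 : q < 1) (p : ℕ) (t : ℝ) :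
    ‖symbol q p t‖ ≤ normLs ∞ fun t => ‖symbol q p t‖ := by
  simpa using abs_le_normLs_top (continuous_norm_symbol hq0 hq1 p) (periodic_norm_symbol q p) t

/-- The principal value of the norm of `wave`. -/
noncomputable def waveMean (q : ℝ) (p : ℕ) (u : ℝ≥0∞) : ℝ :=
  normLs u Real.cos * (2 * Real.pi) ^ (-(u⁻¹).toReal) * normLs u fun t => ‖symbol q p t‖

/-- The quotient inside `kConst` is |G|, so only powers of 2 and π have to be matched. -/
lemma pi_mul_mainConst (q : ℝ) (p : ℕ) (u : ℝ≥0∞) :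
    Real.pi * mainConst q p u = waveMean q p u := by
  have hpi := Real.pi_pos
  unfold mainConst kConst waveMean
  simp_rw [norm_symbol]
  rw [Real.mul_rpow (by norm_num) hpi.le, Real.rpow_add hpi, Real.rpow_one,
    Real.rpow_neg hpi.le]
  field_simp

lemma waveMean_nonneg (q : ℝ) (p : ℕ) (u : ℝ≥0∞) : 0 ≤ waveMean q p u := by
  have := normLs_nonneg u Real.cos
  have := normLs_nonneg u fun t => ‖symbol q p t‖
  unfold waveMean
  positivity

lemma normLs_top_cos : normLs ∞ Real.cos = 1 := by
  refine le_antisymm (normLs_top_le_of_ae_bound zero_le_one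
    (.of_forall fun t => Real.abs_cos_le_one t)) ?_
  simpa using abs_le_normLs_top Real.continuous_cos Real.cos_periodic 0

/-- For fixed t, the wave as a function of θ is a translated cosine of amplitude |G(t)|, and the
norm of the cosine ignores the translation. -/
lemma integral_wave_rpow_phase (q : ℝ) (p m : ℕ) (h0 : u ≠ 0) (ht : u ≠ ∞)
    (t : ℝ) :
    ∫ θ, |wave q p m θ t| ^ u.toReal ∂periodMeasure =
      ‖symbol q p t‖ ^ u.toReal * normLs u Real.cos ^ u.toReal := by
  rw [← normLs_comp_add Real.continuous_cos Real.cos_periodic u (m * t + (symbol q p t).arg),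
    normLs_rpow h0 ht (memLp_of_continuous (by fun_prop) u), ← integral_const_mul]
  congr 1; ext θ
  rw [wave_eq_norm_mul_cos, abs_mul, abs_norm, Real.mul_rpow (norm_nonneg _) (abs_nonneg _)]

lemma average_wave_rpow (hq0 : 0 ≤ q) (hq1 : q < 1) (p m : ℕ) (h0 : u ≠ 0) (ht : u ≠ ∞) :
    Integrable (fun θ => normLs u (wave q p m θ) ^ u.toReal) periodMeasure ∧
    ⨍ θ, normLs u (wave q p m θ) ^ u.toReal ∂periodMeasure = waveMean q p u ^ u.toReal := by
  have hr : 0 < u.toReal := ENNReal.toReal_pos h0 ht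
  have hc : Continuous fun x : ℝ × ℝ => |wave q p m x.1 x.2| ^ u.toReal :=
    (continuous_wave_uncurry hq0 hq1 p m).abs.rpow_const fun _ => Or.inr hr.le
  have hint : Integrable (fun x : ℝ × ℝ => |wave q p m x.1 x.2| ^ u.toReal)
      (periodMeasure.prod periodMeasure) := by
    refine Integrable.of_bound hc.aestronglyMeasurable
      ((normLs ∞ fun t => ‖symbol q p t‖) ^ u.toReal) (.of_forall fun x => ?_)
    rw [Real.norm_eq_abs, abs_of_nonneg (by positivity)]
    exact Real.rpow_le_rpow (abs_nonneg _)
      ((abs_wave_le _ _ _ _ _).trans (norm_symbol_le_top hq0 hq1 p _)) hr.le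
  have hb : ∀ θ, normLs u (wave q p m θ) ^ u.toReal =
      ∫ t, |wave q p m θ t| ^ u.toReal ∂periodMeasure := fun θ =>
    normLs_rpow h0 ht (memLp_of_continuous (continuous_wave hq0 hq1 p m θ) u)
  simp_rw [hb]
  refine ⟨hint.integral_prod_left, ?_⟩
  rw [average_eq, integral_integral_swap hint]
  simp_rw [integral_wave_rpow_phase q p m h0 ht]
  have hg := normLs_rpow h0 ht (memLp_of_continuous (continuous_norm_symbol hq0 hq1 p) u)
  simp_rw [abs_norm] at hg
  rw [integral_mul_const, ← hg, waveMean, Measure.real, periodMeasure_univ,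
    ENNReal.toReal_ofReal Real.two_pi_pos.le, smul_eq_mul]
  have n1 := normLs_nonneg u Real.cos
  have n2 := normLs_nonneg u fun t => ‖symbol q p t‖
  rw [Real.mul_rpow (by positivity) n2, Real.mul_rpow n1 (by positivity),
    ← Real.rpow_mul Real.two_pi_pos.le, ENNReal.toReal_inv, neg_mul, inv_mul_cancel₀ hr.ne',
    Real.rpow_neg_one]
  ring

/-- For finite u a function takes values on both sides of its average. For u = ∞ the principal value
is max |G|: it bounds every wave, and it is reached by the phase that aligns the cosine with a
maximum point of |G|. -/
lemma exists_wave_ge_le (hq0 : 0 ≤ q) (hq1 : q < 1) (p m : ℕ) (hu : 1 ≤ u) :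
    (∃ θ, waveMean q p u ≤ normLs u (wave q p m θ)) ∧
      ∃ θ, normLs u (wave q p m θ) ≤ waveMean q p u := by
  have h0 : u ≠ 0 := (zero_lt_one.trans_le hu).ne'
  rcases eq_or_ne u ∞ with rfl | ht
  · have hN : waveMean q p ∞ = normLs ∞ fun t => ‖symbol q p t‖ := by
      rw [waveMean, normLs_top_cos]; simp
    rw [hN]
    constructor
    · obtain ⟨t₀, -, ht₀⟩ := (isCompact_Icc (a := (0 : ℝ)) (b := 2 * Real.pi)).exists_isMaxOn
        ⟨0, by simp [Real.pi_pos.le]⟩ (continuous_norm_symbol hq0 hq1 p).continuousOn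
      refine ⟨-(m * t₀ + (symbol q p t₀).arg), ?_⟩
      have h1 := abs_le_normLs_top (continuous_wave hq0 hq1 p m (-(m * t₀ + (symbol q p t₀).arg)))
        (periodic_wave q p m _) t₀
      rw [wave_eq_norm_mul_cos, neg_add_cancel, Real.cos_zero, mul_one, abs_norm] at h1
      refine le_trans (normLs_top_le_of_ae_bound (norm_nonneg _) ?_) h1
      rw [periodMeasure]
      filter_upwards [ae_restrict_mem measurableSet_Ioc] with t ht
      rw [abs_norm]
      exact ht₀ (Set.Ioc_subset_Icc_self ht)
    · refine ⟨0, normLs_mono (memLp_of_continuous (continuous_norm_symbol hq0 hq1 p) _) fun t => ?_⟩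
      rw [abs_norm]
      exact abs_wave_le _ _ _ _ _
  · have hr : 0 < u.toReal := ENNReal.toReal_pos h0 ht
    obtain ⟨hi, ha⟩ := average_wave_rpow hq0 hq1 p m h0 ht
    obtain ⟨θ₁, h1⟩ := exists_average_le periodMeasure_ne_zero hi
    obtain ⟨θ₂, h2⟩ := exists_le_average periodMeasure_ne_zero hi
    rw [ha] at h1 h2
    exact ⟨⟨θ₁, (Real.rpow_le_rpow_iff (waveMean_nonneg _ _ _) (normLs_nonneg _ _) hr).1 h1⟩,
      ⟨θ₂, (Real.rpow_le_rpow_iff (normLs_nonneg _ _) (waveMean_nonneg _ _ _) hr).1 h2⟩⟩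

/-- Translating t by τ, with mτ ≡ θ₂ - θ₁ modulo 2π and 0 ≤ τ < 2π/m, converts the phase θ₁ into θ₂;
only the slowly varying G is disturbed. -/
lemma normLs_wave_le_add (hq0 : 0 ≤ q) (hq1 : q < 1) (p : ℕ) {m : ℕ} (hm : 0 < m) (hu : 1 ≤ u)
    {M : ℝ} (hM : ∀ τ, |τ| ≤ 2 * Real.pi / m →
      normLs u (fun t => ‖symbol q p (t + τ) - symbol q p t‖) ≤ M) (θ₁ θ₂ : ℝ) :
    normLs u (wave q p m θ₁) ≤ normLs u (wave q p m θ₂) + M := by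
  have hm0 : (0 : ℝ) < m := by exact_mod_cast hm
  set τ := toIcoMod Real.two_pi_pos 0 (θ₂ - θ₁) / m with hτ
  have hmem := toIcoMod_mem_Ico Real.two_pi_pos 0 (θ₂ - θ₁)
  rw [zero_add] at hmem
  have hτ2 : |τ| ≤ 2 * Real.pi / m := by
    rw [abs_of_nonneg (div_nonneg hmem.1 hm0.le)]
    exact div_le_div_of_nonneg_right hmem.2.le hm0.le
  obtain ⟨z, hz⟩ : ∃ z : ℤ, m * τ + θ₁ = θ₂ - z * (2 * Real.pi) := by
    refine ⟨toIcoDiv Real.two_pi_pos 0 (θ₂ - θ₁), ?_⟩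
    have := toIcoMod_add_toIcoDiv_zsmul Real.two_pi_pos 0 (θ₂ - θ₁)
    rw [zsmul_eq_mul] at this
    rw [hτ, mul_div_cancel₀ _ hm0.ne']
    linarith
  have hc₁ := continuous_wave hq0 hq1 p m θ₁
  have hc₂ := continuous_wave hq0 hq1 p m θ₂
  have hs := continuous_symbol hq0 hq1 p
  rw [← normLs_comp_add hc₁ (periodic_wave q p m θ₁) u τ]
  refine (normLs_le_add hu (f := fun t => wave q p m θ₁ (t + τ)) (by fun_prop) hc₂).trans ?_
  refine add_le_add le_rfl (le_trans (normLs_mono (memLp_of_continuous ?_ u) ?_) (hM τ hτ2))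
  · fun_prop
  · intro t
    have h1 : wave q p m θ₁ (t + τ) - wave q p m θ₂ t =
        ((symbol q p (t + τ) - symbol q p t) *
          Complex.exp ((m * t + θ₂ : ℝ) * Complex.I)).re := by
      have h2 : ((m * (t + τ) + θ₁ : ℝ) : ℂ) * Complex.I =
          ((m * t + θ₂ : ℝ) : ℂ) * Complex.I - z * (2 * Real.pi * Complex.I) := by
        have : m * (t + τ) + θ₁ = m * t + θ₂ - z * (2 * Real.pi) := by linarith
        rw [this]; push_cast; ring
      unfold wave
      rw [h2, Complex.exp_periodic.sub_int_mul_eq z, ← Complex.sub_re, sub_mul]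
    rw [h1, abs_norm]
    refine (Complex.abs_re_le_norm _).trans ?_
    rw [norm_mul, Complex.norm_exp_ofReal_mul_I, mul_one]

lemma abs_normLs_wave_sub_le (hq0 : 0 ≤ q) (hq1 : q < 1) (p : ℕ) {m : ℕ} (hm : 0 < m) (hu : 1 ≤ u)
    {M : ℝ} (hM : ∀ τ, |τ| ≤ 2 * Real.pi / m →
      normLs u (fun t => ‖symbol q p (t + τ) - symbol q p t‖) ≤ M) (θ : ℝ) :
    |normLs u (wave q p m θ) - waveMean q p u| ≤ M := by
  obtain ⟨⟨θ₁, h1⟩, ⟨θ₂, h2⟩⟩ := exists_wave_ge_le hq0 hq1 p m hu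
  have h3 := normLs_wave_le_add hq0 hq1 p hm hu hM θ θ₂
  have h4 := normLs_wave_le_add hq0 hq1 p hm hu hM θ₁ θ
  rw [abs_le]
  constructor <;> linarith

/-- Writing (Re z)² = |z|²/2 + Re(z²)/2, the second part integrates to zero, so the phase disappears
from the L₂ norm. -/
lemma normLs_two_wave_sq (hq0 : 0 ≤ q) (hq1 : q < 1) (p : ℕ) {m : ℕ} (hm : m ≠ 0) (θ : ℝ) :
    normLs 2 (wave q p m θ) ^ (2 : ℝ) = ∫ t, ‖symbol q p t‖ ^ 2 / 2 ∂periodMeasure := by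
  have h := normLs_rpow (u := 2) (by norm_num) (by norm_num)
    (memLp_of_continuous (continuous_wave hq0 hq1 p m θ) 2)
  simp only [ENNReal.toReal_ofNat] at h
  rw [h]
  have hs := continuous_symbol hq0 hq1 p
  let P : ℝ → ℂ := fun t => (symbol q p t * Complex.exp (t * Complex.I) ^ m) ^ 2
  have hP : Integrable P periodMeasure := by
    have : Continuous P := by fun_prop
    exact this.integrableOn_Ioc
  have hterm : ∀ t, |wave q p m θ t| ^ (2 : ℝ) = ‖symbol q p t‖ ^ 2 / 2 +
      (Complex.exp (θ * Complex.I) ^ 2 / 2 * P t).re := by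
    intro t
    have h1 : Complex.exp (θ * Complex.I) ^ 2 / 2 * P t =
        (symbol q p t * Complex.exp ((m * t + θ : ℝ) * Complex.I)) ^ 2 / 2 := by
      have : ((m * t + θ : ℝ) : ℂ) * Complex.I = m * (t * Complex.I) + θ * Complex.I := by
        push_cast; ring
      rw [this, Complex.exp_add, Complex.exp_nat_mul]
      simp only [P]; ring
    have h2 : ‖symbol q p t‖ =
        ‖symbol q p t * Complex.exp ((m * t + θ : ℝ) * Complex.I)‖ := by
      rw [norm_mul, Complex.norm_exp_ofReal_mul_I, mul_one]
    have h3 : |wave q p m θ t| ^ (2 : ℝ) = wave q p m θ t ^ 2 := by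
      rw [← sq_abs (wave q p m θ t)]; exact_mod_cast Real.rpow_natCast _ 2
    rw [h3, h1, h2, ← Complex.normSq_eq_norm_sq]
    unfold wave
    generalize symbol q p t * Complex.exp ((m * t + θ : ℝ) * Complex.I) = z
    have : (z ^ 2 / 2).re = (z.re ^ 2 - z.im ^ 2) / 2 := by
      have h4 : (z ^ 2 / 2) = z ^ 2 / ((2 : ℝ) : ℂ) := by norm_num
      rw [h4, Complex.div_ofReal_re, sq, Complex.mul_re]; ring
    rw [this, Complex.normSq_apply]; ring
  simp_rw [hterm]
  have hi2 : Integrable (fun t => Complex.exp (θ * Complex.I) ^ 2 / 2 * P t) periodMeasure :=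
    hP.const_mul _
  have h5 : ∫ t, (Complex.exp (θ * Complex.I) ^ 2 / 2 * P t).re ∂periodMeasure = 0 := by
    have := integral_re hi2
    simp only [RCLike.re_eq_complex_re] at this
    rw [this, integral_const_mul, integral_symbol_sq hq0 hq1 p hm]
    simp
  have hi3 : Integrable (fun t => (Complex.exp (θ * Complex.I) ^ 2 / 2 * P t).re) periodMeasure :=
    hi2.re
  rw [integral_add (integrable_of_continuous (by fun_prop)) hi3, h5, add_zero]

lemma normLs_two_wave_eq (hq0 : 0 ≤ q) (hq1 : q < 1) (p : ℕ) {m : ℕ} (hm : m ≠ 0) (θ : ℝ) :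
    normLs 2 (wave q p m θ) = waveMean q p 2 := by
  obtain ⟨⟨θ₁, h1⟩, ⟨θ₂, h2⟩⟩ := exists_wave_ge_le (u := 2) hq0 hq1 p m one_le_two
  have key : ∀ θ', normLs 2 (wave q p m θ) = normLs 2 (wave q p m θ') := by
    intro θ'
    refine (Real.rpow_left_inj (normLs_nonneg _ _) (normLs_nonneg _ _) two_ne_zero).1 ?_
    rw [normLs_two_wave_sq hq0 hq1 p hm, normLs_two_wave_sq hq0 hq1 p hm]
  exact le_antisymm (key θ₂ ▸ h2) (key θ₁ ▸ h1)

/-- The exponent σ records three estimates: the integrated Poisson bound for u = 1, p = 1; the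
termwise sum q/(1-q)² for other u with p = 1; and 2q/(1-q)³ for p ≥ 2. The termwise ones pay 2π for
passing from a uniform bound to the norm. -/
lemma normLs_symbol_sub_le (hq0 : 0 ≤ q) (hq1 : q < 1) {p : ℕ} (hp : 1 ≤ p) (hu : 1 ≤ u) (τ : ℝ) :
    normLs u (fun t => ‖symbol q p (t + τ) - symbol q p t‖) ≤
      4 * Real.pi * q * |τ| / (1 - q) ^ sigmaExp u p := by
  have hs := continuous_symbol hq0 hq1 p
  have h1q : 0 < 1 - q := by linarith
  have hpi := Real.pi_pos
  have gen : ∀ S : ℝ, 0 ≤ S →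
      HasSum (fun j : ℕ => ((min (j + 1) p : ℕ) : ℝ) * (j * q ^ j)) S →
      normLs u (fun t => ‖symbol q p (t + τ) - symbol q p t‖) ≤ 2 * Real.pi * (|τ| * S) := by
    intro S hS0 hS
    refine normLs_le_of_bound hu (by positivity) fun t => ?_
    rw [abs_norm]
    exact norm_symbol_sub_le hq0 hq1 p hS t τ
  have hsum := summable_min_mul hq0 hq1 p
  have hnn : 0 ≤ ∑' j : ℕ, ((min (j + 1) p : ℕ) : ℝ) * (j * q ^ j) :=
    tsum_nonneg fun j => by positivity
  have h0 := gen _ hnn hsum.hasSum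
  unfold sigmaExp
  split_ifs with hp1 hu1
  · subst hp1 hu1
    rw [normLs_one (memLp_of_continuous (by fun_prop) 1)]
    have hpos : ∀ t : ℝ, 1 - 2 * q * Real.cos t + q ^ 2 ≠ 0 := by
      intro t
      rw [← normSq_one_sub]
      exact (Complex.normSq_pos.2 (one_sub_ne_zero hq0 hq1 t)).ne'
    have hc : Continuous fun t : ℝ => (1 - 2 * q * Real.cos t + q ^ 2)⁻¹ :=
      Continuous.inv₀ (by fun_prop) hpos
    have hcτ : Continuous fun t : ℝ => (1 - 2 * q * Real.cos (t + τ) + q ^ 2)⁻¹ :=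
      hc.comp (continuous_add_const τ)
    have hper : Function.Periodic (fun t : ℝ => (1 - 2 * q * Real.cos t + q ^ 2)⁻¹)
        (2 * Real.pi) := fun t => by simp only [Real.cos_add_two_pi]
    have hinv : ∫ t : ℝ, (1 - 2 * q * Real.cos (t + τ) + q ^ 2)⁻¹ ∂periodMeasure =
        2 * Real.pi / (1 - q ^ 2) := by
      have hnn : ∀ t : ℝ, 0 ≤ (1 - 2 * q * Real.cos t + q ^ 2)⁻¹ := by
        intro t
        rw [← normSq_one_sub]
        exact inv_nonneg.2 (Complex.normSq_nonneg _)
      have h1 := normLs_comp_add hc hper 1 τ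
      rw [normLs_one (memLp_of_continuous hc 1),
        normLs_one (memLp_of_continuous hcτ 1)] at h1
      simp only [abs_of_nonneg (hnn _)] at h1
      rw [h1, integral_poisson hq0 hq1]
    have hi1 : Integrable (fun t : ℝ => (1 - 2 * q * Real.cos (t + τ) + q ^ 2)⁻¹) periodMeasure :=
      integrable_of_continuous hcτ
    calc _ ≤ ∫ t : ℝ, q * |τ| / 2 * ((1 - 2 * q * Real.cos (t + τ) + q ^ 2)⁻¹ +
            (1 - 2 * q * Real.cos t + q ^ 2)⁻¹) ∂periodMeasure := by
          refine integral_mono (integrable_of_continuous (by fun_prop))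
            (integrable_of_continuous (continuous_const.mul (hcτ.add hc))) fun t => ?_
          dsimp only
          rw [abs_norm]
          exact norm_symbol_one_sub_le hq0 hq1 t τ
      _ = q * |τ| * (2 * Real.pi) / (1 - q ^ 2) := by
          rw [integral_const_mul, integral_add hi1 (integrable_of_continuous hc), hinv,
            integral_poisson hq0 hq1]
          ring
      _ ≤ _ := by
          rw [pow_one]
          refine div_le_div₀ (by positivity) ?_ h1q (by nlinarith)
          nlinarith [mul_nonneg hq0 (abs_nonneg τ), mul_nonneg (mul_nonneg hq0 (abs_nonneg τ)) hpi.le]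
  · subst hp1
    rw [tsum_min_one hq0 hq1] at h0
    refine h0.trans ?_
    rw [← mul_div_assoc, ← mul_div_assoc]
    refine div_le_div_of_nonneg_right ?_ (by positivity)
    nlinarith [mul_nonneg (mul_nonneg hq0 (abs_nonneg τ)) hpi.le]
  · calc _ ≤ 2 * Real.pi * (|τ| * (2 * q / (1 - q) ^ 3)) := by
          refine h0.trans ?_
          gcongr
          exact tsum_min_le hq0 hq1 p
      _ = _ := by ring

/-- The norm of `wave` differs from its principal value by at most a multiple of `q/m`. -/
lemma abs_normLs_wave_sub_le_remainder (hq0 : 0 ≤ q) (hq1 : q < 1) {p m : ℕ} (hp : 1 ≤ p)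
    (hm : 0 < m) (hu : 1 ≤ u) (θ : ℝ) :
    |normLs u (wave q p m θ) - waveMean q p u| ≤
      8 * Real.pi ^ 2 * (q * deltaInd u / (m * (1 - q) ^ sigmaExp u p)) := by
  unfold deltaInd
  split_ifs with h2
  · subst h2
    rw [normLs_two_wave_eq hq0 hq1 p hm.ne']; simp
  · have h1q : 0 < 1 - q := by linarith
    have hpi := Real.pi_pos
    have hm0 : (0 : ℝ) < m := by exact_mod_cast hm
    refine abs_normLs_wave_sub_le hq0 hq1 p hm hu (fun τ hτ => ?_) θ
    refine (normLs_symbol_sub_le hq0 hq1 hp hu τ).trans ?_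
    calc _ ≤ 4 * Real.pi * q * (2 * Real.pi / m) / (1 - q) ^ sigmaExp u p := by gcongr
      _ = _ := by field_simp; ring

end

/-! ### Comparison of the kernel with a wave -/

section
variable {q : ℝ} {ψ : ℕ → ℝ}

lemma hasSum_wave (hq0 : 0 ≤ q) (hq1 : q < 1) (p m : ℕ) (θ t : ℝ) :
    HasSum (fun j : ℕ => ((min (j + 1) p : ℕ) : ℝ) * q ^ j * Real.cos (((m + j : ℕ) : ℝ) * t + θ))
      (wave q p m θ t) := by
  have h := Complex.hasSum_re ((hasSum_symbol hq0 hq1 p t).mul_right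
    (Complex.exp ((m * t + θ : ℝ) * Complex.I)))
  refine (hasSum_congr fun j => ?_).1 h
  have e1 : ((min (j + 1) p : ℕ) : ℂ) * (q * Complex.exp (t * Complex.I)) ^ j *
      Complex.exp ((m * t + θ : ℝ) * Complex.I) =
      ((((min (j + 1) p : ℕ) : ℝ) * q ^ j : ℝ) : ℂ) *
        Complex.exp ((((m + j : ℕ) : ℝ) * t + θ : ℝ) * Complex.I) := by
    have : ((((m + j : ℕ) : ℝ) * t + θ : ℝ) : ℂ) * Complex.I =
        j * (t * Complex.I) + (m * t + θ : ℝ) * Complex.I := by push_cast; ring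
    rw [this, Complex.exp_add, Complex.exp_nat_mul, Complex.ofReal_mul, Complex.ofReal_pow,
      Complex.ofReal_natCast]
    ring
  rw [e1, Complex.re_ofReal_mul, Complex.exp_ofReal_mul_I_re]

/-- All terms below m = n-p+1 vanish, and at k = m + j the multiplier is min(j+1, p)/p, matching the
coefficients of the symbol. -/
lemma hasSum_vpKernel (hs : Summable ψ) (β : ℝ) {n p : ℕ} (hp : 1 ≤ p) {m : ℕ}
    (hm : m = n - p + 1) (hψm : 0 < ψ m) (t : ℝ) :
    HasSum (fun j : ℕ => ((min (j + 1) p : ℕ) : ℝ) * (ψ (m + j) / ψ m) *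
      Real.cos (((m + j : ℕ) : ℝ) * t + -(β * Real.pi / 2)))
      (p / ψ m * vpKernel ψ β n p t) := by
  have h0 : HasSum (fun k : ℕ => vpMult n p k * ψ k * Real.cos (k * t - β * Real.pi / 2))
      (vpKernel ψ β n p t) :=
    (Summable.of_norm_bounded (summable_vpMult_mul hs n p)
      fun k => abs_cosSeries_term_le (fun k => vpMult n p k * ψ k) _ _ _).hasSum
  rw [← hasSum_nat_add_iff' m, Finset.sum_eq_zero, sub_zero] at h0
  · refine (hasSum_congr fun j => ?_).1 (h0.mul_left (p / ψ m))
    have h1 : j + m - (n - p) = j + 1 := by omega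
    have hp0 : (p : ℝ) ≠ 0 := by positivity
    rw [vpMult, h1, add_comm j m, sub_eq_add_neg]
    field_simp
  · intro k hk
    rw [Finset.mem_range] at hk
    rw [vpMult_eq_zero (by omega)]; ring

lemma abs_normLs_vpKernel_sub_le (hq0 : 0 ≤ q) (hq1 : q < 1) (hs : Summable ψ) (β : ℝ) {n p : ℕ}
    (hp : 1 ≤ p) {m : ℕ} (hm : m = n - p + 1) (hψm : 0 < ψ m) {u : ℝ≥0∞} (hu : 1 ≤ u)
    (hD : Summable fun j : ℕ => ((min (j + 1) p : ℕ) : ℝ) * |ψ (m + j) / ψ m - q ^ j|) :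
    |p / ψ m * normLs u (vpKernel ψ β n p) - normLs u (wave q p m (-(β * Real.pi / 2)))| ≤
      2 * Real.pi * ∑' j : ℕ, ((min (j + 1) p : ℕ) : ℝ) * |ψ (m + j) / ψ m - q ^ j| := by
  have hp0 : (0 : ℝ) < p := by exact_mod_cast hp
  set D := ∑' j : ℕ, ((min (j + 1) p : ℕ) : ℝ) * |ψ (m + j) / ψ m - q ^ j|
  have hD0 : 0 ≤ D := tsum_nonneg fun j => by positivity
  have hK := continuous_vpKernel hs β n p
  have hW := continuous_wave hq0 hq1 p m (-(β * Real.pi / 2))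
  have hpt : ∀ t, |p / ψ m * vpKernel ψ β n p t - wave q p m (-(β * Real.pi / 2)) t| ≤ D := by
    intro t
    have h := (hasSum_vpKernel hs β hp hm hψm t).sub
      (hasSum_wave hq0 hq1 p m (-(β * Real.pi / 2)) t)
    rw [← h.tsum_eq, ← Real.norm_eq_abs]
    refine tsum_of_norm_bounded hD.hasSum fun j => ?_
    rw [← sub_mul, ← mul_sub, norm_mul, norm_mul, Real.norm_natCast, Real.norm_eq_abs,
      Real.norm_eq_abs]
    exact mul_le_of_le_one_right (by positivity) (Real.abs_cos_le_one _)
  have e : normLs u (fun t => p / ψ m * vpKernel ψ β n p t) =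
      p / ψ m * normLs u (vpKernel ψ β n p) := by
    rw [normLs_const_mul, abs_of_pos (by positivity)]
  have hc : Continuous fun t => p / ψ m * vpKernel ψ β n p t := by fun_prop
  have h1 := normLs_le_add hu hc hW
  have h2 := normLs_le_add hu hW hc
  have h3 := normLs_le_of_bound hu hD0 hpt
  have h4 := normLs_le_of_bound hu hD0 fun t => (abs_sub_comm _ _).trans_le (hpt t)
  rw [e] at h1 h2
  rw [abs_le]
  constructor <;> linarith

/-- The ratio picks up one factor within ε of q at each step, and d_j = (q+ε)^j - q^j solves the
recursion d_{j+1} = d_j(q+ε) + εq^j for the worst error. -/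
lemma abs_ratio_sub_pow_le {ε : ℝ} (hψ : ∀ k : ℕ, 1 ≤ k → 0 < ψ k) (hq0 : 0 ≤ q) {m : ℕ}
    (hm : 1 ≤ m) (hε : ∀ k ≥ m, |ψ (k + 1) / ψ k - q| ≤ ε) (j : ℕ) :
    |ψ (m + j) / ψ m - q ^ j| ≤ (q + ε) ^ j - q ^ j := by
  induction j with
  | zero => simp [div_self (hψ m hm).ne']
  | succ j ih =>
    set x := ψ (m + j + 1) / ψ (m + j) with hx
    have hε' := hε (m + j) (by omega)
    have hx0 : 0 ≤ x := (div_pos (hψ _ (by omega)) (hψ _ (by omega))).le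
    have hxle : x ≤ q + ε := by
      have := (abs_le.1 hε').2
      linarith
    have e : ψ (m + (j + 1)) / ψ m - q ^ (j + 1) =
        (ψ (m + j) / ψ m - q ^ j) * x + q ^ j * (x - q) := by
      have h1 := (hψ m hm).ne'
      have h2 := (hψ (m + j) (by omega)).ne'
      rw [hx, ← add_assoc]
      field_simp
      ring
    rw [e]
    have hqj : 0 ≤ q ^ j := by positivity
    calc _ ≤ |ψ (m + j) / ψ m - q ^ j| * x + q ^ j * |x - q| := by
          refine (abs_add_le _ _).trans_eq ?_
          rw [abs_mul, abs_mul, abs_of_nonneg hx0, abs_of_nonneg hqj]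
      _ ≤ ((q + ε) ^ j - q ^ j) * (q + ε) + q ^ j * ε := by
          gcongr
          exact (abs_nonneg _).trans ih
      _ = _ := by ring

lemma hasSum_succ_mul_pow {x : ℝ} (h0 : 0 ≤ x) (h1 : x < 1) :
    HasSum (fun j : ℕ => ((j : ℝ) + 1) * x ^ j) (1 / (1 - x) ^ 2) := by
  have h := hasSum_choose_mul_geometric_of_norm_lt_one (r := x) 1
    (by rwa [Real.norm_eq_abs, abs_of_nonneg h0])
  refine (hasSum_congr fun j => ?_).1 h
  rw [Nat.choose_one_right]; push_cast; rfl

/-- The error made when `ψ(m + j)/ψ(m)` is replaced by `q^j`, for ratios close to `q`. -/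
lemma tsum_min_mul_abs_le {ε : ℝ} (hψ : ∀ k : ℕ, 1 ≤ k → 0 < ψ k) (hq0 : 0 ≤ q) (hq1 : q < 1)
    {m : ℕ} (hm : 1 ≤ m) (hε : ∀ k ≥ m, |ψ (k + 1) / ψ k - q| ≤ ε) (hε1 : ε ≤ (1 - q) / 2)
    (p : ℕ) :
    ∑' j : ℕ, ((min (j + 1) p : ℕ) : ℝ) * |ψ (m + j) / ψ m - q ^ j| ≤
      8 * (ε / (1 - q) ^ 2 * min (p : ℝ) (1 / (1 - q))) := by
  have hε0 : 0 ≤ ε := (abs_nonneg _).trans (hε m le_rfl)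
  have hr := abs_ratio_sub_pow_le hψ hq0 hm hε
  have h1q : 0 < 1 - q := by linarith
  have hρ0 : 0 ≤ q + ε := by positivity
  have hρ : (1 - q) / 2 ≤ 1 - (q + ε) := by linarith
  have hρ1 : q + ε < 1 := by linarith
  have hρ2 : 0 < 1 - (q + ε) := by linarith
  have hA := ((hasSum_geometric_of_lt_one hρ0 hρ1).sub
    (hasSum_geometric_of_lt_one hq0 hq1)).mul_left (p : ℝ)
  have hB := (hasSum_succ_mul_pow hρ0 hρ1).sub (hasSum_succ_mul_pow hq0 hq1)
  -- The two entries of the minimum come from min(j+1,p) ≤ p and min(j+1,p) ≤ j+1. The resulting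
  -- series are differences of values at q+ε and q, and ε ≤ (1-q)/2 keeps 1-(q+ε) comparable to 1-q.
  have bA : ∀ j : ℕ, ((min (j + 1) p : ℕ) : ℝ) * |ψ (m + j) / ψ m - q ^ j| ≤
      p * ((q + ε) ^ j - q ^ j) := by
    intro j
    gcongr
    · exact min_le_right _ _
    · exact hr j
  have bB : ∀ j : ℕ, ((min (j + 1) p : ℕ) : ℝ) * |ψ (m + j) / ψ m - q ^ j| ≤
      (j + 1) * (q + ε) ^ j - (j + 1) * q ^ j := by
    intro j
    rw [← mul_sub]
    gcongr
    · exact_mod_cast min_le_left _ _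
    · exact hr j
  have hS : Summable fun j : ℕ => ((min (j + 1) p : ℕ) : ℝ) * |ψ (m + j) / ψ m - q ^ j| :=
    Summable.of_nonneg_of_le (fun j => by positivity) bA hA.summable
  have hc : 0 ≤ 8 * (ε / (1 - q) ^ 2) := by positivity
  rw [← mul_assoc, mul_min_of_nonneg _ _ hc]
  refine le_min ?_ ?_
  · refine (hS.tsum_le_tsum bA hA.summable).trans ?_
    rw [hA.tsum_eq]
    have e : (1 - (q + ε))⁻¹ - (1 - q)⁻¹ = ε / ((1 - (q + ε)) * (1 - q)) := by
      field_simp; ring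
    have : ε / ((1 - (q + ε)) * (1 - q)) ≤ 8 * (ε / (1 - q) ^ 2) := by
      rw [mul_div_assoc', div_le_div_iff₀ (by positivity) (by positivity)]
      have : (1 - q) ^ 2 ≤ 8 * ((1 - (q + ε)) * (1 - q)) := by nlinarith
      nlinarith
    rw [e, mul_comm]
    exact mul_le_mul_of_nonneg_right this (by positivity)
  · refine (hS.tsum_le_tsum bB hB.summable).trans ?_
    rw [hB.tsum_eq]
    have e : 1 / (1 - (q + ε)) ^ 2 - 1 / (1 - q) ^ 2 =
        ε * ((1 - (q + ε)) + (1 - q)) / ((1 - (q + ε)) ^ 2 * (1 - q) ^ 2) := by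
      field_simp; ring
    have h2 : (1 - q) ^ 2 ≤ 4 * (1 - (q + ε)) ^ 2 := by nlinarith
    calc _ = ε * ((1 - (q + ε)) + (1 - q)) / ((1 - (q + ε)) ^ 2 * (1 - q) ^ 2) := e
      _ ≤ ε * (2 * (1 - q)) / ((1 - q) ^ 2 / 4 * (1 - q) ^ 2) := by
          gcongr
          · linarith
          · linarith
      _ = _ := by field_simp; ring

/-! ### Consequences of the ratio limit -/

/-- Both are the ratio test. The weight k+1 is what later bounds the error series uniformly in p. -/
lemma summable_of_ratio (hψ : ∀ k : ℕ, 1 ≤ k → 0 < ψ k) (hq1 : q < 1)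
    (hlim : Tendsto (fun k : ℕ => ψ (k + 1) / ψ k) atTop (𝓝 q)) :
    Summable ψ ∧ Summable fun k : ℕ => ((k : ℝ) + 1) * ψ k := by
  have hpos : ∀ᶠ k : ℕ in atTop, 0 < ψ k := by
    filter_upwards [eventually_ge_atTop 1] with k hk using hψ k hk
  constructor
  · refine summable_of_ratio_test_tendsto_lt_one hq1 (hpos.mono fun k hk => hk.ne') ?_
    refine hlim.congr' ?_
    filter_upwards [eventually_ge_atTop 1] with k hk
    rw [Real.norm_of_nonneg (hψ k hk).le, Real.norm_of_nonneg (hψ (k + 1) (by omega)).le]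
  · refine summable_of_ratio_test_tendsto_lt_one hq1
      (hpos.mono fun k hk => (mul_pos (by positivity) hk).ne') ?_
    have h1 := (tendsto_one_div_add_atTop_nhds_zero_nat (𝕜 := ℝ)).const_add 1
    have h2 := h1.mul hlim
    rw [add_zero, one_mul] at h2
    refine h2.congr' ?_
    filter_upwards [eventually_ge_atTop 1] with k hk
    have hk1 := hψ k hk
    have hk2 := hψ (k + 1) (by omega)
    rw [Real.norm_of_nonneg (by positivity), Real.norm_of_nonneg (by positivity)]
    push_cast
    field_simp

lemma bddAbove_epsSeq (hlim : Tendsto (fun k : ℕ => ψ (k + 1) / ψ k) atTop (𝓝 q)) (m : ℕ) :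
    BddAbove ((fun k : ℕ => |ψ (k + 1) / ψ k - q|) '' Set.Ici m) := by
  have h := (hlim.sub_const q).abs.bddAbove_range
  exact h.mono (Set.image_subset_range _ _)

lemma le_epsSeq (hlim : Tendsto (fun k : ℕ => ψ (k + 1) / ψ k) atTop (𝓝 q)) {m k : ℕ}
    (hk : m ≤ k) : |ψ (k + 1) / ψ k - q| ≤ epsSeq ψ q m :=
  le_csSup (bddAbove_epsSeq hlim m) ⟨k, hk, rfl⟩

lemma epsSeq_nonneg (hlim : Tendsto (fun k : ℕ => ψ (k + 1) / ψ k) atTop (𝓝 q)) (m : ℕ) :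
    0 ≤ epsSeq ψ q m := (abs_nonneg _).trans (le_epsSeq hlim le_rfl)

lemma exists_epsSeq_le (hlim : Tendsto (fun k : ℕ => ψ (k + 1) / ψ k) atTop (𝓝 q)) {δ : ℝ}
    (hδ : 0 < δ) : ∃ N, ∀ m ≥ N, epsSeq ψ q m ≤ δ := by
  obtain ⟨N, hN⟩ := Metric.tendsto_atTop.1 hlim δ hδ
  refine ⟨N, fun m hm => csSup_le ⟨_, m, Set.self_mem_Ici, rfl⟩ ?_⟩
  rintro _ ⟨k, hk, rfl⟩
  exact (hN k (hm.trans hk)).le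

lemma summable_succ_mul_abs_sub (hψ : ∀ k : ℕ, 1 ≤ k → 0 < ψ k) (hq0 : 0 ≤ q) (hq1 : q < 1)
    (hlim : Tendsto (fun k : ℕ => ψ (k + 1) / ψ k) atTop (𝓝 q)) {m : ℕ} (hm : 1 ≤ m) :
    Summable fun j : ℕ => ((j : ℝ) + 1) * |ψ (m + j) / ψ m - q ^ j| := by
  have h1 := ((summable_nat_add_iff m).2 (summable_of_ratio hψ hq1 hlim).2).mul_right (ψ m)⁻¹
  refine Summable.of_nonneg_of_le (fun j => by positivity) (fun j => ?_)
    (h1.add (hasSum_succ_mul_pow hq0 hq1).summable)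
  have hp1 := hψ (m + j) (by omega)
  have hp2 := hψ m hm
  have h2 : |ψ (m + j) / ψ m - q ^ j| ≤ ψ (m + j) / ψ m + q ^ j := by
    refine (abs_sub _ _).trans_eq ?_
    rw [abs_of_pos (by positivity), abs_of_nonneg (by positivity)]
  calc _ ≤ ((j : ℝ) + 1) * (ψ (m + j) / ψ m + q ^ j) := by gcongr
    _ = (((j : ℝ) + 1) * ψ (m + j)) * (ψ m)⁻¹ + (j + 1) * q ^ j := by ring
    _ ≤ _ := by
        rw [add_comm j m]
        gcongr
        linarith [(Nat.cast_nonneg m : (0 : ℝ) ≤ m)]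

/-- Summability and the bounds for the error series, with an absolute constant for large `m`. -/
lemma exists_error_bound (hψ : ∀ k : ℕ, 1 ≤ k → 0 < ψ k) (hq0 : 0 ≤ q) (hq1 : q < 1)
    (hlim : Tendsto (fun k : ℕ => ψ (k + 1) / ψ k) atTop (𝓝 q)) :
    ∃ (N : ℕ) (B : ℝ), 0 ≤ B ∧ ∀ m p : ℕ, 1 ≤ m → 1 ≤ p →
      (Summable fun j : ℕ => ((min (j + 1) p : ℕ) : ℝ) * |ψ (m + j) / ψ m - q ^ j|) ∧
      ∑' j : ℕ, ((min (j + 1) p : ℕ) : ℝ) * |ψ (m + j) / ψ m - q ^ j| ≤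
        B * (epsSeq ψ q m / (1 - q) ^ 2 * min (p : ℝ) (1 / (1 - q))) ∧
      (N < m → ∑' j : ℕ, ((min (j + 1) p : ℕ) : ℝ) * |ψ (m + j) / ψ m - q ^ j| ≤
        8 * (epsSeq ψ q m / (1 - q) ^ 2 * min (p : ℝ) (1 / (1 - q)))) := by
  have h1q : 0 < 1 - q := by linarith
  obtain ⟨N, hN⟩ := exists_epsSeq_le hlim (half_pos h1q)
  let D : ℕ → ℝ := fun m => ∑' j : ℕ, ((j : ℝ) + 1) * |ψ (m + j) / ψ m - q ^ j|
  have hD0 : ∀ m, 0 ≤ D m := fun m => tsum_nonneg fun j => by positivity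
  have hε0 := epsSeq_nonneg hlim
  have hsum0 : 0 ≤ ∑ m ∈ Finset.range (N + 1), D m / epsSeq ψ q m :=
    Finset.sum_nonneg fun m _ => div_nonneg (hD0 m) (hε0 m)
  -- Beyond N the constant 8 suffices. Each of the finitely many m ≤ N contributes the p-independent
  -- majorant D(m) relative to ε_m; a term with ε_m = 0 is 0 under division by zero and is not
  -- needed.
  refine ⟨N, 8 + ∑ m ∈ Finset.range (N + 1), D m / epsSeq ψ q m, by positivity, ?_⟩
  intro m p hm hp
  have hp1 : (1 : ℝ) ≤ p := by exact_mod_cast hp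
  have hmin : 1 ≤ min (p : ℝ) (1 / (1 - q)) :=
    le_min hp1 (by rw [le_div_iff₀ h1q]; linarith)
  have hT : epsSeq ψ q m ≤ epsSeq ψ q m / (1 - q) ^ 2 * min (p : ℝ) (1 / (1 - q)) := by
    have h2 : epsSeq ψ q m ≤ epsSeq ψ q m / (1 - q) ^ 2 := by
      rw [le_div_iff₀ (by positivity)]
      refine mul_le_of_le_one_right (hε0 m) ?_
      nlinarith
    exact h2.trans (le_mul_of_one_le_right ((hε0 m).trans h2) hmin)
  have hT0 := (hε0 m).trans hT
  have hdom : ∀ j : ℕ, ((min (j + 1) p : ℕ) : ℝ) * |ψ (m + j) / ψ m - q ^ j| ≤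
      ((j : ℝ) + 1) * |ψ (m + j) / ψ m - q ^ j| := by
    intro j
    gcongr
    exact_mod_cast min_le_left _ _
  have hS' := summable_succ_mul_abs_sub hψ hq0 hq1 hlim hm
  have hS : Summable fun j : ℕ => ((min (j + 1) p : ℕ) : ℝ) * |ψ (m + j) / ψ m - q ^ j| :=
    Summable.of_nonneg_of_le (fun j => by positivity) hdom hS'
  have hlarge : N < m → ∑' j : ℕ, ((min (j + 1) p : ℕ) : ℝ) * |ψ (m + j) / ψ m - q ^ j| ≤
      8 * (epsSeq ψ q m / (1 - q) ^ 2 * min (p : ℝ) (1 / (1 - q))) := fun h =>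
    tsum_min_mul_abs_le hψ hq0 hq1 hm (fun k hk => le_epsSeq hlim hk) (hN m h.le) p
  refine ⟨hS, ?_, hlarge⟩
  rcases lt_or_ge N m with h | h
  · exact (hlarge h).trans (mul_le_mul_of_nonneg_right (by linarith) hT0)
  -- If ε_m = 0 the smallness condition on ε holds for this m as well, so the estimate used for
  -- large m applies.
  rcases (hε0 m).eq_or_lt with h0 | h0
  · have h2 := tsum_min_mul_abs_le hψ hq0 hq1 hm (fun k hk => le_epsSeq hlim hk)
      (by rw [← h0]; positivity) p
    exact h2.trans (mul_le_mul_of_nonneg_right (by linarith) hT0)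
  · have h2 : D m / epsSeq ψ q m ≤ ∑ m ∈ Finset.range (N + 1), D m / epsSeq ψ q m :=
      Finset.single_le_sum (f := fun m => D m / epsSeq ψ q m)
        (fun m _ => div_nonneg (hD0 m) (hε0 m)) (Finset.mem_range.2 (by omega))
    calc _ ≤ D m := hS.tsum_le_tsum hdom hS'
      _ = D m / epsSeq ψ q m * epsSeq ψ q m := (div_mul_cancel₀ _ h0.ne').symm
      _ ≤ _ := mul_le_mul (by linarith) hT h0.le (by positivity)

/-! ### The normalised kernel norm -/

lemma deltaInd_eq {s s' : ℝ≥0∞} (hss : s⁻¹ + s'⁻¹ = 1) : deltaInd s = deltaInd s' := by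
  have key : ∀ a b : ℝ≥0∞, a⁻¹ + b⁻¹ = 1 → a = 2 → b = 2 := by
    rintro a b h rfl
    rw [← ENNReal.inv_two_add_inv_two] at h
    exact inv_injective ((ENNReal.add_right_inj (by simp)).1 h)
  unfold deltaInd
  have : s = 2 ↔ s' = 2 := ⟨key s s' hss, key s' s (by rwa [add_comm])⟩
  simp only [this]

/-- The normalised norm of the kernel. -/
noncomputable def kernelConst (ψ : ℕ → ℝ) (β : ℝ) (n p : ℕ) (s' : ℝ≥0∞) : ℝ :=
  1 / Real.pi * (p / ψ (n - p + 1) * normLs s' (vpKernel ψ β n p))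

lemma remainder_terms_nonneg (hq0 : 0 ≤ q) (hq1 : q < 1)
    (hlim : Tendsto (fun k : ℕ => ψ (k + 1) / ψ k) atTop (𝓝 q)) (s s' : ℝ≥0∞) (m p : ℕ) :
    0 ≤ q * deltaInd s / ((m : ℝ) * (1 - q) ^ sigmaExp s' p) ∧
      0 ≤ epsSeq ψ q m / (1 - q) ^ 2 * min (p : ℝ) (1 / (1 - q)) := by
  have h1q : 0 < 1 - q := by linarith
  have hd : 0 ≤ deltaInd s := by unfold deltaInd; split_ifs <;> norm_num
  have hε := epsSeq_nonneg hlim m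
  have hmin : 0 ≤ min (p : ℝ) (1 / (1 - q)) := le_min (by positivity) (by positivity)
  constructor <;> positivity

lemma exists_kernelConst_bound (hψ : ∀ k : ℕ, 1 ≤ k → 0 < ψ k) (hq0 : 0 ≤ q) (hq1 : q < 1)
    (hlim : Tendsto (fun k : ℕ => ψ (k + 1) / ψ k) atTop (𝓝 q)) :
    ∃ (N : ℕ) (B : ℝ), 0 ≤ B ∧ ∀ (β : ℝ) (s s' : ℝ≥0∞), s⁻¹ + s'⁻¹ = 1 →
      ∀ n p : ℕ, 1 ≤ p →
        |kernelConst ψ β n p s' - mainConst q p s'| ≤ B * remainder ψ q s s' (n - p + 1) p ∧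
        (N ≤ n - p → |kernelConst ψ β n p s' - mainConst q p s'| ≤
          8 * Real.pi * remainder ψ q s s' (n - p + 1) p) := by
  obtain ⟨N, B, hB, h⟩ := exists_error_bound hψ hq0 hq1 hlim
  have hpi := Real.pi_pos
  have hpi3 := Real.pi_gt_three
  refine ⟨N, 2 * B + 8 * Real.pi, by positivity, ?_⟩
  intro β s s' hss n p hp
  set m := n - p + 1 with hm
  obtain ⟨hS, h1, h2⟩ := h m p (by omega) hp
  have hu : 1 ≤ s' := by
    rw [← ENNReal.inv_le_one, ← hss]; exact le_add_self
  have hs := (summable_of_ratio hψ hq1 hlim).1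
  have hk := abs_normLs_vpKernel_sub_le hq0 hq1 hs β hp hm (hψ m (by omega)) hu hS
  have hw := abs_normLs_wave_sub_le_remainder hq0 hq1 hp (by omega : 0 < m) hu
    (-(β * Real.pi / 2))
  rw [← deltaInd_eq hss, ← pi_mul_mainConst] at hw
  obtain ⟨n1, n2⟩ := remainder_terms_nonneg (ψ := ψ) hq0 hq1 hlim s s' m p
  set T₁ := q * deltaInd s / ((m : ℝ) * (1 - q) ^ sigmaExp s' p)
  set T₂ := epsSeq ψ q m / (1 - q) ^ 2 * min (p : ℝ) (1 / (1 - q))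
  set D := ∑' j : ℕ, ((min (j + 1) p : ℕ) : ℝ) * |ψ (m + j) / ψ m - q ^ j|
  have hR : remainder ψ q s s' m p = T₁ + T₂ := rfl
  -- The difference splits into kernel minus wave, costing 2D, and wave minus principal value,
  -- costing 8πT₁. Since D ≤ 8T₂ for large m and 16 ≤ 8π, the absolute constant becomes 8π.
  have key : |kernelConst ψ β n p s' - mainConst q p s'| ≤ 2 * D + 8 * Real.pi * T₁ := by
    have e : kernelConst ψ β n p s' - mainConst q p s' = 1 / Real.pi *
        ((p / ψ m * normLs s' (vpKernel ψ β n p) - normLs s' (wave q p m (-(β * Real.pi / 2)))) +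
        (normLs s' (wave q p m (-(β * Real.pi / 2))) - Real.pi * mainConst q p s')) := by
      unfold kernelConst
      rw [← hm]
      field_simp
      ring
    rw [e, abs_mul, abs_of_pos (by positivity : 0 < 1 / Real.pi)]
    calc _ ≤ 1 / Real.pi * (2 * Real.pi * D + 8 * Real.pi ^ 2 * T₁) :=
          mul_le_mul_of_nonneg_left ((abs_add_le _ _).trans (add_le_add hk hw)) (by positivity)
      _ = _ := by field_simp
  rw [hR]
  refine ⟨key.trans ?_, fun hN => key.trans ?_⟩
  · nlinarith [mul_nonneg hB n1, mul_nonneg hpi.le n2]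
  · have := h2 (by omega)
    nlinarith

/-- When R = 0 the hypothesis forces X = A and θ = 0 works. A single θ must satisfy every available
bound c at once, as it has to meet both the absolute and the ψ-dependent one. -/
lemma exists_theta {X A R : ℝ} (hR : 0 ≤ R) {c₀ : ℝ} (h₀ : |X - A| ≤ c₀ * R) :
    ∃ θ : ℝ, X = A + θ * R ∧ ∀ c, |X - A| ≤ c * R → 0 ≤ c → |θ| ≤ c := by
  rcases hR.eq_or_lt with h | h
  · refine ⟨0, ?_, fun c _ hc => by simpa using hc⟩
    rw [← h, mul_zero] at h₀
    have := abs_nonpos_iff.1 h₀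
    linarith
  · refine ⟨(X - A) / R, ?_, fun c hc _ => ?_⟩
    · rw [div_mul_cancel₀ _ h.ne']; ring
    · rw [abs_div, abs_of_pos h, div_le_iff₀ h]; exact hc

end

end DeLaValleePoussin

/-! ### The main theorem -/

open DeLaValleePoussin
theorem mainTheorem1 :
    ∃ C : ℝ, ∀ (q : ℝ) (ψ : ℕ → ℝ), 0 < q → q < 1 → (∀ k : ℕ, 1 ≤ k → 0 < ψ k) →
      Tendsto (fun k : ℕ => ψ (k + 1) / ψ k) atTop (𝓝 q) →
      ∃ (N : ℕ) (C' : ℝ), ∀ (β : ℝ) (s s' : ℝ≥0∞), 1 ≤ s → s⁻¹ + s'⁻¹ = 1 →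
        ∀ n p : ℕ, 1 ≤ p → p ≤ n →
        ∀ f φ : ℝ → ℝ, MemCPsiBeta ψ β s f φ →
          (∃ θ : ℝ, |θ| ≤ C' ∧ (N ≤ n - p → |θ| ≤ C) ∧
            normC (vpDeviation n p f) ≤
              ψ (n - p + 1) / p *
                (mainConst q p s' + θ * remainder ψ q s s' (n - p + 1) p) *
                bestApprox s (n - p + 1) φ) ∧
          (∃ F Φ : ℝ → ℝ, MemCPsiBeta ψ β s F Φ ∧
            bestApprox s (n - p + 1) Φ = bestApprox s (n - p + 1) φ ∧
            ∃ θ : ℝ, |θ| ≤ C' ∧ (N ≤ n - p → |θ| ≤ C) ∧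
              normC (vpDeviation n p F) =
                ψ (n - p + 1) / p *
                  (mainConst q p s' + θ * remainder ψ q s s' (n - p + 1) p) *
                  bestApprox s (n - p + 1) Φ) := by
  -- The kernel asymptotics account for 8π; the added 1 pays for the loss η in the extremal
  -- function.
  refine ⟨8 * Real.pi + 1, fun q ψ hq0 hq1 hψ hlim => ?_⟩
  obtain ⟨N, B, hB, hbound⟩ := exists_kernelConst_bound hψ hq0.le hq1 hlim
  refine ⟨N, B + 1, fun β s s' hs1 hss n p hp hpn f φ hf => ?_⟩
  obtain ⟨hb1, hb2⟩ := hbound β s s' hss n p hp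
  have hpi := Real.pi_pos
  have hs := (summable_of_ratio hψ hq1 hlim).1
  have hψm := hψ (n - p + 1) (by omega)
  have hp0 : (0 : ℝ) < p := by exact_mod_cast hp
  set m := n - p + 1 with hm
  have hm0 : (0 : ℝ) < m := by rw [hm]; positivity
  obtain ⟨hT1, hT2⟩ := remainder_terms_nonneg (ψ := ψ) hq0.le hq1 hlim s s' m p
  have hR : 0 ≤ remainder ψ q s s' m p := add_nonneg hT1 hT2
  have hRpos : s ≠ 2 → 0 < remainder ψ q s s' m p := by
    intro h
    refine add_pos_of_pos_of_nonneg ?_ hT2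
    have h1q : 0 < 1 - q := by linarith
    rw [deltaInd, if_neg h]
    positivity
  set A := mainConst q p s'
  set R := remainder ψ q s s' m p
  set X := kernelConst ψ β n p s' with hX
  have hXK : 1 / Real.pi * normLs s' (vpKernel ψ β n p) = ψ m / p * X := by
    rw [hX, kernelConst, ← hm]
    field_simp
  have hX0 : 0 ≤ X := by
    have := normLs_nonneg s' (vpKernel ψ β n p)
    rw [hX, kernelConst]
    positivity
  -- a value close to `X` has the required form
  have hform : ∀ Y, |Y - A| ≤ |X - A| + R → ∃ θ : ℝ, |θ| ≤ B + 1 ∧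
      (N ≤ n - p → |θ| ≤ 8 * Real.pi + 1) ∧ Y = A + θ * R := by
    intro Y hY
    have h1 : |Y - A| ≤ (B + 1) * R := by linarith
    obtain ⟨θ, e, hθ⟩ := exists_theta hR h1
    refine ⟨θ, hθ _ h1 (by positivity), fun hN => hθ _ ?_ (by positivity), e⟩
    have := hb2 hN
    linarith
  have hup := normC_vpDeviation_le hψ hs hss hf hp hpn
  rw [hXK] at hup
  obtain ⟨θ₀, a1, a2, a3⟩ := hform X (by linarith)
  refine ⟨⟨θ₀, a1, a2, a3 ▸ hup⟩, ?_⟩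
  have hE0 := bestApprox_nonneg s m φ
  have hdev0 : 0 ≤ normC (vpDeviation n p f) :=
    (abs_nonneg _).trans (abs_vpDeviation_le_normC hψ hs hss hf hp hpn 0)
  -- When the upper bound vanishes it is already an equality for f, so F = f.
  by_cases hzero : X * bestApprox s m φ = 0
  · refine ⟨f, φ, hf, rfl, θ₀, a1, a2, ?_⟩
    rw [← a3]
    refine le_antisymm hup ?_
    rwa [mul_assoc, hzero, mul_zero]
  have hXpos : 0 < X := hX0.lt_of_ne fun h => hzero (by rw [← h, zero_mul])
  have hEpos : 0 < bestApprox s m φ := hE0.lt_of_ne fun h => hzero (by rw [← h, mul_zero])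
  have hKpos : 0 < normLs s' (vpKernel ψ β n p) := by
    have h1 : 0 < ψ m / p * X := by positivity
    rw [← hXK] at h1
    exact (pos_iff_pos_of_mul_pos h1).1 (by positivity)
  -- The loss ηX must be absorbed by R. For s ≠ 2 one has R > 0, leaving room for the positive η
  -- that s = 1 requires; for s = 2 the remainder may vanish, but then η = 0 is allowed.
  obtain ⟨η, hη0, hη1, hηs, hηX⟩ : ∃ η : ℝ, 0 ≤ η ∧ η < 1 ∧ (s = 1 → 0 < η) ∧ η * X ≤ R := by
    by_cases h2 : s = 2
    · exact ⟨0, le_rfl, one_pos, fun h => by norm_num [h] at h2, by simpa using hR⟩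
    · have hRp := hRpos h2
      have : 0 < min (1 / 2) (R / X) := lt_min (by norm_num) (by positivity)
      refine ⟨min (1 / 2) (R / X), this.le, (min_le_left _ _).trans_lt (by norm_num),
        fun _ => this, ?_⟩
      rw [← le_div_iff₀ hXpos]
      exact min_le_right _ _
  obtain ⟨F, Φ, hF, hΦ, hlow⟩ := exists_extremal hψ hs hss hp hpn hKpos hEpos hη0 hη1 hηs
  have hupF := normC_vpDeviation_le hψ hs hss hF hp hpn
  rw [hXK] at hlow hupF
  rw [← hm, hΦ] at hupF
  have hcpos : 0 < ψ m / p * bestApprox s m φ := by positivity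
  -- The normalised deviation of F lies between (1-η)X and X, hence within R of X.
  obtain ⟨θ, b1, b2, b3⟩ := hform (normC (vpDeviation n p F) / (ψ m / p * bestApprox s m φ)) (by
    have l1 : normC (vpDeviation n p F) / (ψ m / p * bestApprox s m φ) ≤ X := by
      rw [div_le_iff₀ hcpos]; linarith
    have l2 : (1 - η) * X ≤ normC (vpDeviation n p F) / (ψ m / p * bestApprox s m φ) := by
      rw [le_div_iff₀ hcpos]; linarith
    have l3 : |normC (vpDeviation n p F) / (ψ m / p * bestApprox s m φ) - X| ≤ R := by
      rw [abs_le]; constructor <;> linarith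
    have l4 := abs_sub_le (normC (vpDeviation n p F) / (ψ m / p * bestApprox s m φ)) X A
    linarith)
  refine ⟨F, Φ, hF, hΦ, θ, b1, b2, ?_⟩
  rw [hΦ, ← b3]
  field_simp
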